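/- \textbf{Setting.} Let $K$ be a number of classes, $\pi$ a probability vector on $[K]$, and $B\in[0,1]^{K\times K}$ a symmetric matrix. In the stochastic blockmodel, the vertices $0,1,2,\dots$ carry i.i.d. labels $Y_i$ with $P(Y_i=k)=\pi_k$ and, given the labels, the entries $A_{ij}$, $i<j$, of the symmetric hollow adjacency matrix are independent Bernoulli$(B_{Y_iY_j})$ variables. Vertex $0$ is the test vertex with unknown label $Y=Y_0$; the training data $\mathcal T_n$ are the labels and the adjacency matrix of the vertices $1,\dots,n$. For each class $q$ let $Q_q=\sum_{k}\mathbf 1_{\{Y=k\}}B_{kq}$, so that $E(Q_q)=\sum_k\pi_kB_{kq}$, $E(Q_qQ_r)=\sum_k\pi_kB_{kq}B_{kr}$, and let $\rho_{qr}=E(Q_qQ_r)/\sqrt{E(Q_q^2)E(Q_r^2)}$. The model is assumed non-degenerate: for each class $q$ with $\pi_q>0$ there is a class $k$ with $\pi_k>0$ and $0<B_{kq}<1$. \textbf{Classifier.} Let $d_1,\dots,d_n\in\mathbb R^n$ be the columns of the training adjacency matrix and $\phi\in\mathbb R^n$ the adjacency column of the test vertex to the training vertices, all scaled to unit $\ell_2$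 norm (zero columns stay zero), and let $D=[d_1,\dots,d_n]$. The sparse representation classifier (SRC) computes a non-negative sparse representation $\beta$ of $\phi$ and answers with a class $k$ minimizing $\|\phi-D\beta_k\|_2$, where $\beta_k$ keeps only the coefficients of the training vertices of class $k$. Fix a sparsity level $s\ge1$. The representation $\beta\ge0$ is obtained by one of the following, with ties broken arbitrarily. \begin{itemize} \item \emph{Exact $\ell_1$ minimization at level $s$}: $\beta$ minimizes $\|\beta\|_1$ subject to $\beta\ge0$ and $\|\phi-D\beta\|_2\le\epsilon$, for any (possibly data-dependent) noise threshold $0\le\epsilon<\|\phi\|_2$ for which there is such a minimizer with $\|\beta\|_0\le s$, and $\beta$ is such a minimizer. (If, because of ties, no threshold gives one, $\beta$ is a minimizer for some such $\epsilon$ that is supported on columns having maximal inner product with $\phi$.) \item \emph{Orthogonal matching pursuit at level $s$}: starting from $\beta=0$ and no selected columns, repeat $s$ times: select a column with largest inner product with the residual $\phi-D\beta$, and replace $\beta$ by a non-negative least squares fit of $\phi$ on all selected columns; if no column has positive inner product with the residual, $\beta$ is left unchanged. \end{itemize} If no such representation exists for the given data, the answer is arbitrary. Let $L_n=P(\hat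 Y_n\ne Y\mid\mathcal T_n)$ be the conditional probability of error of the answer $\hat Y_n$. \textbf{Theorem.} Suppose that for every pair of classes $q\ne r$ $$\rho_{qr}^2\cdot\frac{E(Q_r^2)}{E(Q_q^2)}<\frac{E(Q_r)}{E(Q_q)}$$ (in particular, if $K\ge2$, all these denominators are positive). Then for every fixed $s\ge1$, SRC with non-negative representation, implemented either by exact $\ell_1$ minimization or by orthogonal matching pursuit at sparsity level $s$, is consistent for vertex classification: $L_n\to0$ almost surely as $n\to\infty$. -/

import Mathlib

open MeasureTheory ProbabilityTheory Filter Topology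

namespace VertexSRC

/-! ### The stochastic blockmodel -/

/-- `Y i` and `A i j` are the block labels and the adjacency entries of a random simple graph on the
vertices `0, 1, 2, …` that follows the stochastic blockmodel with block priors `prior` and block
communication probabilities `B`: the labels are i.i.d. with law `prior`, and given the labels the
edges `{i, j}`, `i < j`, are independent Bernoulli variables with parameters `B (Y i) (Y j)`.
The field `law` says this as a formula for the joint law on the first `N` vertices, for all `N`. -/
structure IsSBM {Ω : Type*} [MeasurableSpace Ω] (μ : Measure Ω) {K : ℕ} (prior : Fin K → ℝ)
    (B : Matrix (Fin K) (Fin K) ℝ) (Y : ℕ → Ω → Fin K) (A : ℕ → ℕ → Ω → Bool) : Prop where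
  measurable_label : ∀ i, Measurable (Y i)
  measurable_adj : ∀ i j, Measurable (A i j)
  symm : ∀ i j ω, A i j ω = A j i ω
  hollow : ∀ i ω, A i i ω = false
  law : ∀ (N : ℕ) (y : Fin N → Fin K) (a : Fin N → Fin N → Bool),
    (∀ i j, a i j = a j i) → (∀ i, a i i = false) →
    μ.real {ω | (∀ i : Fin N, Y i ω = y i) ∧ ∀ i j : Fin N, A i j ω = a i j} =
      (∏ i, prior (y i)) *
        ∏ i, ∏ j ∈ Finset.Ioi i, if a i j then B (y i) (y j) else 1 - B (y i) (y j)

/-- Expectation of `f Y` for a label `Y` with law `prior`. -/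
def labelExp {K : ℕ} (prior : Fin K → ℝ) (f : Fin K → ℝ) : ℝ := ∑ k, prior k * f k

/-- The variable `Q_q = ∑ k, 1_{Y = k} B k q`, as a function of the label `Y`. -/
def blockVar {K : ℕ} (B : Matrix (Fin K) (Fin K) ℝ) (q : Fin K) : Fin K → ℝ := fun k => B k q

/-- The un-centered correlation `ρ_{qr} = E(Q_q Q_r) / √(E(Q_q²) E(Q_r²))`. -/
noncomputable def rho {K : ℕ} (prior : Fin K → ℝ) (B : Matrix (Fin K) (Fin K) ℝ)
    (q r : Fin K) : ℝ :=
  labelExp prior (blockVar B q * blockVar B r) /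
    √(labelExp prior (blockVar B q ^ 2) * labelExp prior (blockVar B r ^ 2))

/-! ### Non-negative sparse representation -/

section Sparse

variable {ι : Type*} [Fintype ι] [DecidableEq ι]
  {E : Type*} [NormedAddCommGroup E] [InnerProductSpace ℝ E]

/-- `D β`, where `D` is the matrix with columns `d j`. -/
def synth (d : ι → E) (β : ι → ℝ) : E := ∑ j, β j • d j

/-- The set of indices of nonzero coefficients; its cardinality is `‖β‖₀`. -/
noncomputable def supp (β : ι → ℝ) : Finset ι := {j | β j ≠ 0}

/-- `β` minimizes `‖β‖₁` subject to `β ≥ 0` and `‖φ - D β‖₂ ≤ ε`. -/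
structure IsNonnegL1Min (d : ι → E) (φ : E) (ε : ℝ) (β : ι → ℝ) : Prop where
  nonneg : ∀ j, 0 ≤ β j
  feasible : ‖φ - synth d β‖ ≤ ε
  minimal : ∀ β' : ι → ℝ, (∀ j, 0 ≤ β' j) → ‖φ - synth d β'‖ ≤ ε → ∑ j, |β j| ≤ ∑ j, |β' j|

/-- `β` is an exact solution of the non-negative `ℓ1` problem for some noise threshold
`0 ≤ ε < ‖φ‖`. (For `ε ≥ ‖φ‖` the only solution is `0`, which represents nothing.) -/
def IsL1Solution (d : ι → E) (φ : E) (β : ι → ℝ) : Prop :=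
  ∃ ε : ℝ, 0 ≤ ε ∧ ε < ‖φ‖ ∧ IsNonnegL1Min d φ ε β

/-- `β` is a representation found by exact non-negative `ℓ1` minimization at sparsity level `s`:
an exact solution, for some noise threshold, with at most `s` nonzero coefficients. If no
noise threshold gives such a solution (columns are tied at the very first step, and
more than `s` of them become active at once), `β` is an exact solution supported on the columns that
are most correlated with `φ`. -/
def IsL1Representation (s : ℕ) (d : ι → E) (φ : E) (β : ι → ℝ) : Prop :=
  IsL1Solution d φ β ∧
    ((supp β).card ≤ s ∨
      ((∀ β', IsL1Solution d φ β' → s < (supp β').card) ∧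
        ∀ j ∈ supp β, ∀ i, inner ℝ (d i) φ ≤ inner ℝ (d j) φ))

/-- `β` is a non-negative least squares fit of `φ` by the columns `d j`, `j ∈ S`. -/
structure IsNonnegLeastSquares (d : ι → E) (φ : E) (S : Finset ι) (β : ι → ℝ) : Prop where
  nonneg : ∀ j, 0 ≤ β j
  supported : ∀ j, j ∉ S → β j = 0
  minimal : ∀ β' : ι → ℝ, (∀ j, 0 ≤ β' j) → (∀ j, j ∉ S → β' j = 0) →
    ‖φ - synth d β‖ ≤ ‖φ - synth d β'‖

/-- `OMPState d φ t S β`: after `t` iterations, non-negative orthogonal matching pursuit may have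
selected the columns `S` and have the coefficients `β`. An iteration selects a column most correlated
with the current residual and refits by non-negative least squares on all selected columns;
if no column is positively correlated with the residual, nothing changes any more. -/
inductive OMPState (d : ι → E) (φ : E) : ℕ → Finset ι → (ι → ℝ) → Prop
  | start : OMPState d φ 0 ∅ 0
  | select {t : ℕ} {S : Finset ι} {β : ι → ℝ} (j : ι) (β' : ι → ℝ) :
      OMPState d φ t S β →
      0 < inner ℝ (d j) (φ - synth d β) →
      (∀ i, inner ℝ (d i) (φ - synth d β) ≤ inner ℝ (d j) (φ - synth d β)) →
      IsNonnegLeastSquares d φ (insert j S) β' →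
      OMPState d φ (t + 1) (insert j S) β'
  | halt {t : ℕ} {S : Finset ι} {β : ι → ℝ} :
      OMPState d φ t S β →
      (∀ i, inner ℝ (d i) (φ - synth d β) ≤ 0) →
      OMPState d φ (t + 1) S β

/-- `β` is a representation found by non-negative orthogonal matching pursuit at sparsity level `s`,
that is, after `s` iterations. -/
def IsOMPRepresentation (s : ℕ) (d : ι → E) (φ : E) (β : ι → ℝ) : Prop :=
  ∃ S, OMPState d φ s S β

/-- The distance `‖φ - D β_k‖₂` of `φ` to class `k`, where `β_k` keeps only the coefficients of the
columns with label `k`. -/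
noncomputable def classResidual {K : ℕ} (y : ι → Fin K) (d : ι → E) (φ : E) (β : ι → ℝ)
    (k : Fin K) : ℝ :=
  ‖φ - synth d (fun j => if y j = k then β j else 0)‖

end Sparse

/-! ### The sparse representation classifier on adjacency data -/

/-- A 0-1 vector, scaled to unit `ℓ2` norm (the zero vector stays zero). -/
noncomputable def unitVec {n : ℕ} (v : Fin n → Bool) : EuclideanSpace ℝ (Fin n) :=
  let x : EuclideanSpace ℝ (Fin n) := WithLp.toLp 2 (fun i => if v i then (1 : ℝ) else 0)
  ‖x‖⁻¹ • x

/-- The normalized adjacency columns of the training vertices. -/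
noncomputable def dictionary {n : ℕ} (a : Fin n → Fin n → Bool) :
    Fin n → EuclideanSpace ℝ (Fin n) :=
  fun j => unitVec (fun i => a i j)

/-- A sequence of vertex classifiers into `K` classes: for `n` training vertices it receives their
labels, their adjacency matrix, and the adjacency column of the test vertex to them. -/
abbrev Classifier (K : ℕ) : Type :=
  (n : ℕ) → (Fin n → Fin K) → (Fin n → Fin n → Bool) → (Fin n → Bool) → Fin K

/-- `g` is a sparse representation classifier with the given notion `Rep` of representation: whenever
the scaled test column has a representation by the normalized training columns, `g` answers with a
class of least residual for one such representation. All ties are broken in any way. -/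
def IsSRC {K : ℕ}
    (Rep : ∀ {n : ℕ}, (Fin n → EuclideanSpace ℝ (Fin n)) → EuclideanSpace ℝ (Fin n) →
      (Fin n → ℝ) → Prop) (g : Classifier K) : Prop :=
  ∀ (n : ℕ) (y : Fin n → Fin K) (a : Fin n → Fin n → Bool) (v : Fin n → Bool),
    (∃ β, Rep (dictionary a) (unitVec v) β) →
    ∃ β, Rep (dictionary a) (unitVec v) β ∧
      ∀ k, classResidual y (dictionary a) (unitVec v) β (g n y a v) ≤
        classResidual y (dictionary a) (unitVec v) β k

/-- SRC implemented by exact non-negative `ℓ1` minimization at sparsity level `s`. -/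
def IsL1SRC {K : ℕ} (s : ℕ) (g : Classifier K) : Prop :=
  IsSRC (fun d φ β => IsL1Representation s d φ β) g

/-- SRC implemented by non-negative orthogonal matching pursuit at sparsity level `s`. -/
def IsOMPSRC {K : ℕ} (s : ℕ) (g : Classifier K) : Prop :=
  IsSRC (fun d φ β => IsOMPRepresentation s d φ β) g

/-! ### The conditional probability of error; the test vertex is `0`, the training vertices are
`1, …, n` -/

section Error

variable {Ω : Type*} [mΩ : MeasurableSpace Ω] {K : ℕ}

/-- The training data: labels and adjacency matrix of the vertices `1, …, n`. -/
def trainData (Y : ℕ → Ω → Fin K) (A : ℕ → ℕ → Ω → Bool) (n : ℕ) (ω : Ω) :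
    (Fin n → Fin K) × (Fin n → Fin n → Bool) :=
  (fun i => Y (i + 1) ω, fun i j => A (i + 1) (j + 1) ω)

/-- The adjacency column of the test vertex to the vertices `1, …, n`. -/
def testColumn (A : ℕ → ℕ → Ω → Bool) (n : ℕ) (ω : Ω) : Fin n → Bool :=
  fun i => A (i + 1) 0 ω

/-- The event that the test vertex is misclassified. -/
def errorEvent (Y : ℕ → Ω → Fin K) (A : ℕ → ℕ → Ω → Bool) (g : Classifier K) (n : ℕ) : Set Ω :=
  {ω | g n (trainData Y A n ω).1 (trainData Y A n ω).2 (testColumn A n ω) ≠ Y 0 ω}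

/-- `L_n`, the conditional probability of error given the training data. -/
noncomputable def condError (μ : Measure Ω) (Y : ℕ → Ω → Fin K) (A : ℕ → ℕ → Ω → Bool)
    (g : Classifier K) (n : ℕ) : Ω → ℝ :=
  μ[(errorEvent Y A g n).indicator (fun _ => (1 : ℝ)) |
    MeasurableSpace.comap (trainData Y A n) inferInstance]

end Error

end VertexSRC

namespace VertexSRC

/-! ### Non-negative sparse representation of separated data -/

section Sparse

variable {ι : Type*} [Fintype ι]
  {E : Type*} [NormedAddCommGroup E] [InnerProductSpace ℝ E]

/-! The argument separates geometry from probability. Scaled adjacency columns of distinct vertices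
of classes `q` and `r` have inner product close to c(q,r) = E(Q_q Q_r)/√(E Q_q · E Q_r)
(`limitCos`). The hypothesis on ρ, rearranged, says c(r,q) < c(q,q) for r ≠ q, and non-degeneracy
says c(q,q) < 1. With finitely many classes both hold with one margin η (`exists_limitCos_margin`).

Geometry (`IsSeparated`): suppose all inner products are within a small δ of c and each class that
occurs has more than `s` members. Then both algorithms select only columns of the class `q` of the
test vertex. A sparse ℓ1 solution must have small total mass, because an active column correlates
less with the residual than an inactive column of its own class; the residual is then almost φ,
which correlates best with class `q` (`label_eq_of_l1_sparse`). In matching pursuit, a fit by at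
most `s` columns of class `q` has coefficient sum below 1 by a fixed amount, so part of φ remains,
and an unselected column of class `q` beats every column of another class (`sum_lt_of_leastSquares`,
`label_eq_of_ompStep`). A representation that lies in class `q` and shortens the residual gives the
answer `q` (`eq_of_classResidual_le`).

Probability: given the labels of two vertices, what the other vertices see of them is i.i.d.
(`measureReal_pair`). A Chernoff bound and a union bound make all degrees, common-neighbor counts
and class sizes typical outside an event of exponentially small probability
(`measureReal_not_isTypical_le`). The error probabilities are thus summable, so the sum of the L_n
has finite expectation and L_n → 0 almost surely (`ae_tendsto_condError`). -/

theorem inner_synth_right (d : ι → E) (β : ι → ℝ) (x : E) :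
    inner ℝ x (synth d β) = ∑ j, β j * inner ℝ x (d j) := by
  simp [synth, inner_sum, inner_smul_right]

theorem inner_synth_left (d : ι → E) (β : ι → ℝ) (x : E) :
    inner ℝ (synth d β) x = ∑ j, β j * inner ℝ (d j) x := by
  simp [synth, sum_inner, inner_smul_left]

theorem synth_add (d : ι → E) (β γ : ι → ℝ) : synth d (β + γ) = synth d β + synth d γ := by
  simp [synth, add_smul, Finset.sum_add_distrib]

theorem synth_smul (d : ι → E) (t : ℝ) (β : ι → ℝ) : synth d (t • β) = t • synth d β := by
  simp [synth, mul_smul, Finset.smul_sum]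

theorem synth_sub (d : ι → E) (β γ : ι → ℝ) : synth d (β - γ) = synth d β - synth d γ := by
  simp [synth, sub_smul]

theorem synth_zero (d : ι → E) : synth d (0 : ι → ℝ) = 0 := by simp [synth]

theorem synth_single [DecidableEq ι] (d : ι → E) (j : ι) :
    synth d (Pi.single j (1 : ℝ)) = d j := by
  rw [synth, Finset.sum_eq_single j] <;> simp +contextual

theorem continuous_synth (d : ι → E) : Continuous (synth d) := by
  unfold synth; fun_prop

/-- Moving a little in a direction positively correlated with `r` shortens `r`. -/
theorem eventually_norm_sub_smul_lt {v r : E} (h : 0 < inner ℝ v r) :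
    ∀ᶠ t : ℝ in 𝓝[>] 0, ‖r - t • v‖ < ‖r‖ := by
  have h1 : Tendsto (fun t : ℝ => t * ‖v‖ ^ 2) (𝓝[>] 0) (𝓝 (0 * ‖v‖ ^ 2)) :=
    (Continuous.tendsto (by fun_prop) _).mono_left nhdsWithin_le_nhds
  rw [zero_mul] at h1
  filter_upwards [h1.eventually (gt_mem_nhds (show (0 : ℝ) < 2 * inner ℝ v r by linarith)),
    self_mem_nhdsWithin] with t ht ht0
  have ht0 : 0 < t := ht0
  apply lt_of_pow_lt_pow_left₀ 2 (norm_nonneg _)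
  rw [norm_sub_sq_real, inner_smul_right, norm_smul, mul_pow, Real.norm_eq_abs, sq_abs,
    real_inner_comm]
  nlinarith

/-- On the support of an `ℓ1` solution the correlation with the residual is maximal. -/
theorem IsNonnegL1Min.inner_le [DecidableEq ι] {d : ι → E} {φ : E} {ε : ℝ} {β : ι → ℝ}
    (hβ : IsNonnegL1Min d φ ε β) {j : ι} (hj : β j ≠ 0) (i : ι) :
    inner ℝ (d i) (φ - synth d β) ≤ inner ℝ (d j) (φ - synth d β) := by
  by_contra! h
  have hij : i ≠ j := by rintro rfl; exact lt_irrefl _ h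
  have hjpos : 0 < β j := lt_of_le_of_ne (hβ.nonneg j) hj.symm
  set r := φ - synth d β
  -- Exchange argument: take mass `t` from `j` and give only `(1 - τ) * t` to `i`. For small `τ` and
  -- `t` the residual still shrinks, while the ℓ1 norm drops by `τ * t`; with `τ = 0` it would only
  -- stay equal.
  have h1 : Tendsto (fun τ : ℝ => inner ℝ ((1 - τ) • d i - d j) r) (𝓝[>] 0)
      (𝓝 (inner ℝ ((1 - 0 : ℝ) • d i - d j) r)) :=
    (Continuous.tendsto (by fun_prop) _).mono_left nhdsWithin_le_nhds
  have hpos : 0 < inner ℝ ((1 - 0 : ℝ) • d i - d j) r := by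
    simp only [sub_zero, one_smul, inner_sub_left]; linarith
  obtain ⟨τ, ⟨hτ, hτ0, hτ1⟩⟩ := ((h1.eventually (lt_mem_nhds hpos)).and
    (Ioo_mem_nhdsGT (zero_lt_one' ℝ))).exists
  obtain ⟨t, ht, ht0, htj⟩ := ((eventually_norm_sub_smul_lt hτ).and
    (Ioo_mem_nhdsGT hjpos)).exists
  let β' : ι → ℝ := β + t • ((1 - τ) • Pi.single i 1 - Pi.single j 1)
  have hnn : ∀ l, 0 ≤ β' l := by
    intro l
    simp only [β', Pi.add_apply, Pi.smul_apply, Pi.sub_apply, smul_eq_mul]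
    rcases eq_or_ne l j with rfl | hl
    · simp [hij.symm]; linarith
    · have := hβ.nonneg l
      rw [Pi.single_eq_of_ne hl]
      have : 0 ≤ (Pi.single i 1 : ι → ℝ) l := by
        rcases eq_or_ne l i with rfl | hli
        · simp
        · simp [hli]
      have : 0 ≤ t * ((1 - τ) * (Pi.single i 1 : ι → ℝ) l - 0) := by
        rw [sub_zero]
        exact mul_nonneg ht0.le (mul_nonneg (by linarith) this)
      linarith
  have hres : φ - synth d β' = r - t • ((1 - τ) • d i - d j) := by
    simp only [β', synth_add, synth_smul, synth_sub, synth_single, r]; abel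
  have := hβ.minimal β' hnn (by rw [hres]; exact ht.le.trans hβ.feasible)
  rw [Finset.sum_congr rfl fun l _ => abs_of_nonneg (hβ.nonneg l),
    Finset.sum_congr rfl fun l _ => abs_of_nonneg (hnn l)] at this
  simp only [β', Pi.add_apply, Pi.smul_apply, Pi.sub_apply, smul_eq_mul, Finset.sum_add_distrib,
    ← Finset.mul_sum, Finset.sum_sub_distrib, Finset.sum_pi_single', Finset.mem_univ,
    if_true] at this
  nlinarith

/-- The residual of a non-negative least squares fit makes no obtuse angle with the fit. -/
theorem IsNonnegLeastSquares.inner_synth_nonneg {d : ι → E} {φ : E} {S : Finset ι} {β : ι → ℝ}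
    (hβ : IsNonnegLeastSquares d φ S β) : 0 ≤ inner ℝ (synth d β) (φ - synth d β) := by
  by_contra! h
  have h' : 0 < inner ℝ (-synth d β) (φ - synth d β) := by rw [inner_neg_left]; linarith
  obtain ⟨t, ht, ht0, ht1⟩ := ((eventually_norm_sub_smul_lt h').and
    (Ioo_mem_nhdsGT (zero_lt_one' ℝ))).exists
  refine absurd (hβ.minimal ((1 - t) • β) (fun j => ?_) (fun j hj => ?_)) (not_le.2 ?_)
  · exact mul_nonneg (by linarith) (hβ.nonneg j)
  · simp [hβ.supported j hj]
  · have : φ - synth d ((1 - t) • β) = φ - synth d β - t • -synth d β := by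
      rw [synth_smul]; module
    rwa [this]

/-- Refitting after the selection of a positively correlated column shortens the residual. -/
theorem IsNonnegLeastSquares.norm_lt [DecidableEq ι] {d : ι → E} {φ : E} {S : Finset ι}
    {β β' : ι → ℝ} {j : ι} (hβ' : IsNonnegLeastSquares d φ (insert j S) β')
    (hnn : ∀ l, 0 ≤ β l) (hsupp : ∀ l, l ∉ S → β l = 0)
    (hj : 0 < inner ℝ (d j) (φ - synth d β)) :
    ‖φ - synth d β'‖ < ‖φ - synth d β‖ := by
  obtain ⟨t, ht, ht0⟩ := ((eventually_norm_sub_smul_lt hj).and self_mem_nhdsWithin).exists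
  have ht0 : 0 < t := ht0
  refine (hβ'.minimal (β + t • Pi.single j 1) (fun l => ?_) (fun l hl => ?_)).trans_lt ?_
  · have : 0 ≤ (Pi.single j 1 : ι → ℝ) l := by
      rcases eq_or_ne l j with rfl | hli
      · simp
      · simp [hli]
    exact add_nonneg (hnn l) (mul_nonneg ht0.le this)
  · rw [Finset.mem_insert, not_or] at hl
    simp [hl.1, hsupp l hl.2]
  · have : φ - synth d (β + t • Pi.single j 1) = φ - synth d β - t • d j := by
      rw [synth_add, synth_smul, synth_single]; abel
    rwa [this]

/-- All terms of the expanded square are non-negative, so the diagonal is a lower bound. This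
coercivity makes the sublevel sets of the least squares problem compact. -/
theorem sum_sq_le_norm_synth_sq {d : ι → E} (hunit : ∀ j, ‖d j‖ = 1)
    (hinner : ∀ i j, 0 ≤ inner ℝ (d i) (d j)) {β : ι → ℝ} (hβ : ∀ j, 0 ≤ β j) :
    ∑ j, β j ^ 2 ≤ ‖synth d β‖ ^ 2 := by
  rw [← real_inner_self_eq_norm_sq, inner_synth_left]
  refine Finset.sum_le_sum fun j _ => ?_
  rw [sq, inner_synth_right]
  refine mul_le_mul_of_nonneg_left ?_ (hβ j)
  have := Finset.single_le_sum (f := fun l => β l * inner ℝ (d j) (d l))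
    (fun l _ => mul_nonneg (hβ l) (hinner j l)) (Finset.mem_univ j)
  simpa [real_inner_self_eq_norm_sq, hunit] using this

/-- Non-negative least squares fits by unit vectors at acute angles exist. -/
theorem exists_isNonnegLeastSquares {d : ι → E} (hunit : ∀ j, ‖d j‖ = 1)
    (hinner : ∀ i j, 0 ≤ inner ℝ (d i) (d j)) (φ : E) (S : Finset ι) :
    ∃ β, IsNonnegLeastSquares d φ S β := by
  let C : Set (ι → ℝ) := {β | (∀ j, 0 ≤ β j) ∧ (∀ j, j ∉ S → β j = 0) ∧
    ‖φ - synth d β‖ ≤ ‖φ‖}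
  have hcont : Continuous fun β => ‖φ - synth d β‖ := by
    have := continuous_synth d
    fun_prop
  have hclosed : IsClosed C := by
    have hS : IsClosed {β : ι → ℝ | ∀ j, j ∉ S → β j = 0} := by
      simp only [Set.ofPred_forall]
      exact isClosed_iInter fun j => isClosed_iInter fun _ =>
        isClosed_eq (continuous_apply j) continuous_const
    exact (isClosed_Ici (a := (0 : ι → ℝ))).inter
      (hS.inter (isClosed_le hcont continuous_const))
  have hbdd : C ⊆ Set.Icc 0 (fun _ => 2 * ‖φ‖) := by
    rintro β ⟨h1, -, h3⟩
    refine ⟨h1, fun j => ?_⟩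
    have h4 : ‖synth d β‖ ≤ 2 * ‖φ‖ := by
      have := norm_sub_norm_le (synth d β) φ
      rw [norm_sub_rev] at this
      linarith
    have h5 := sum_sq_le_norm_synth_sq hunit hinner h1
    have h6 := Finset.single_le_sum (f := fun j => β j ^ 2) (fun l _ => sq_nonneg _)
      (Finset.mem_univ j)
    exact (pow_le_pow_iff_left₀ (h1 j) (norm_nonneg _) two_ne_zero).1 (h6.trans h5) |>.trans h4
  have hzero : (0 : ι → ℝ) ∈ C := by simp [C, synth_zero]
  obtain ⟨β, hβ, hmin⟩ := (isCompact_Icc.of_isClosed_subset hclosed hbdd).exists_isMinOn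
    ⟨0, hzero⟩ hcont.continuousOn
  refine ⟨β, hβ.1, hβ.2.1, fun β' h1 h2 => ?_⟩
  by_cases h : ‖φ - synth d β'‖ ≤ ‖φ‖
  · exact hmin ⟨h1, h2, h⟩
  · exact hβ.2.2.trans (not_le.1 h).le

/-- A feasible non-negative `ℓ1` problem has a solution. -/
theorem exists_isNonnegL1Min (d : ι → E) (φ : E) {ε : ℝ} {γ : ι → ℝ} (hγ : ∀ j, 0 ≤ γ j)
    (hfeas : ‖φ - synth d γ‖ ≤ ε) : ∃ β, IsNonnegL1Min d φ ε β := by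
  let C : Set (ι → ℝ) := {β | (∀ j, 0 ≤ β j) ∧ ‖φ - synth d β‖ ≤ ε ∧
    ∑ j, |β j| ≤ ∑ j, |γ j|}
  have hcont : Continuous fun β => ‖φ - synth d β‖ := by
    have := continuous_synth d
    fun_prop
  have hcont' : Continuous fun β : ι → ℝ => ∑ j, |β j| := by fun_prop
  have hclosed : IsClosed C := by
    refine IsClosed.inter ?_ (IsClosed.inter (isClosed_le hcont continuous_const)
      (isClosed_le hcont' continuous_const))
    exact isClosed_Ici (a := (0 : ι → ℝ))
  have hbdd : C ⊆ Set.Icc 0 (fun _ => ∑ j, |γ j|) := by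
    rintro β ⟨h1, -, h3⟩
    refine ⟨h1, fun j => (le_abs_self _).trans (le_trans ?_ h3)⟩
    exact Finset.single_le_sum (f := fun j => |β j|) (fun l _ => abs_nonneg _) (Finset.mem_univ j)
  obtain ⟨β, hβ, hmin⟩ := (isCompact_Icc.of_isClosed_subset hclosed hbdd).exists_isMinOn
    ⟨γ, hγ, hfeas, le_rfl⟩ hcont'.continuousOn
  refine ⟨β, hβ.1, hβ.2.1, fun β' h1 h2 => ?_⟩
  by_cases h : ∑ j, |β' j| ≤ ∑ j, |γ j|
  · exact hmin ⟨h1, h2, h⟩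
  · exact hβ.2.2.trans (not_le.1 h).le

end Sparse

/-! ### Both algorithms on separated data -/

section Separated

variable {ι : Type*} [Fintype ι]
  {E : Type*} [NormedAddCommGroup E] [InnerProductSpace ℝ E] {K : ℕ}

/-- The unit columns `d j` with labels `y j` and the vector `φ` with label `q` have pairwise inner
products within `δ` of the entries of `c`; the diagonal of `c` stays away from `1`, and `c q q`
dominates the other entries `c r q`, by the margin `η`; every label that occurs does so more than
`s` times. -/
structure IsSeparated (d : ι → E) (φ : E) (y : ι → Fin K) (q : Fin K)
    (c : Fin K → Fin K → ℝ) (s : ℕ) (η δ : ℝ) : Prop where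
  unit : ∀ j, ‖d j‖ = 1
  inner_nonneg : ∀ i j, 0 ≤ inner ℝ (d i) (d j)
  gram : ∀ i j, i ≠ j → |inner ℝ (d i) (d j) - c (y i) (y j)| ≤ δ
  corr : ∀ j, |inner ℝ (d j) φ - c (y j) q| ≤ δ
  self_le : ∀ j, c (y j) (y j) ≤ 1 - η
  gap : ∀ j, y j ≠ q → c (y j) q + η ≤ c q q
  pos : η ≤ c q q
  many : ∀ j, s < Finset.card {i | y i = y j}
  many_test : s < Finset.card {i | y i = q}

variable {d : ι → E} {φ : E} {y : ι → Fin K} {q : Fin K} {c : Fin K → Fin K → ℝ} {s : ℕ} {η δ : ℝ}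

/-- A nonzero coefficient vector supported on class `q` points to class `q`. -/
theorem eq_of_classResidual_le {β : ι → ℝ} (hsupp : ∀ j, β j ≠ 0 → y j = q)
    (hres : ‖φ - synth d β‖ < ‖φ‖) {k : Fin K}
    (hk : ∀ l, classResidual y d φ β k ≤ classResidual y d φ β l) : k = q := by
  by_contra hkq
  have h1 : classResidual y d φ β q = ‖φ - synth d β‖ := by
    rw [classResidual]
    congr 3
    ext j
    split_ifs with h
    · rfl
    · by_contra h0; exact h (hsupp j (Ne.symm h0))
  have h2 : classResidual y d φ β k = ‖φ‖ := by
    have : (fun j => if y j = k then β j else 0) = 0 := by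
      ext j
      split_ifs with h
      · by_contra h0; exact hkq (h ▸ hsupp j h0)
      · rfl
    rw [classResidual, this, synth_zero, sub_zero]
  have := hk q
  rw [h1, h2] at this
  linarith

theorem sum_supp (β : ι → ℝ) : ∑ j ∈ supp β, β j = ∑ j, β j := by
  rw [supp, Finset.sum_filter_ne_zero]

namespace IsSeparated

theorem inner_le_one (h : IsSeparated d φ y q c s η δ) (i j : ι) : inner ℝ (d i) (d j) ≤ 1 := by
  have := real_inner_le_norm (d i) (d j)
  rwa [h.unit, h.unit, one_mul] at this

theorem exists_label_eq (h : IsSeparated d φ y q c s η δ) : ∃ i, y i = q := by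
  obtain ⟨i, hi⟩ := Finset.card_pos.1 (Nat.zero_lt_of_lt h.many_test)
  exact ⟨i, (Finset.mem_filter.1 hi).2⟩

theorem self_test_le (h : IsSeparated d φ y q c s η δ) : c q q ≤ 1 - η := by
  obtain ⟨i, rfl⟩ := h.exists_label_eq
  exact h.self_le i

theorem label_eq_of_maximal (h : IsSeparated d φ y q c s η δ) (hδ : 2 * δ < η) {j : ι}
    (hj : ∀ i, inner ℝ (d i) φ ≤ inner ℝ (d j) φ) : y j = q := by
  by_contra hjq
  obtain ⟨i, hi⟩ := h.exists_label_eq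
  have h1 := abs_le.1 (h.corr i)
  have h2 := abs_le.1 (h.corr j)
  rw [hi] at h1
  linarith [hj i, h.gap j hjq, h1.1, h2.2]

/-- Sparsity enters here: a class too large to be exhausted by `S` offers an unused column as a
competitor. -/
theorem exists_notMem (S : Finset ι) {r : Fin K} (hcard : S.card ≤ s)
    (hr : s < Finset.card {i | y i = r}) : ∃ i, y i = r ∧ i ∉ S := by
  obtain ⟨i, hi, hiS⟩ := Finset.exists_mem_notMem_of_card_lt_card (hcard.trans_lt hr)
  exact ⟨i, (Finset.mem_filter.1 hi).2, hiS⟩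

/-- Optimality makes active columns maximally correlated with the residual. Comparing each with an
inactive column of its class bounds its coefficient, so the total mass `b` is at most `η / 4`.
Correlations with the residual then differ from those with φ by at most `b`, too little to close the
gap `η`. -/
theorem label_eq_of_l1_sparse [DecidableEq ι] (h : IsSeparated d φ y q c s η δ)
    (hδ0 : 0 ≤ δ) (hη : 0 < η)
    (hη1 : η ≤ 1) (hδ : 16 * (s + 1) * δ ≤ η ^ 2) {ε : ℝ} {β : ι → ℝ}
    (hβ : IsNonnegL1Min d φ ε β) (hcard : (supp β).card ≤ s) {j : ι} (hj : β j ≠ 0) :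
    y j = q := by
  set b := ∑ l, β l with hb
  have hb0 : 0 ≤ b := Finset.sum_nonneg fun l _ => hβ.nonneg l
  have hs0 : (0 : ℝ) ≤ s := Nat.cast_nonneg s
  have key : ∀ l ∈ supp β, η * β l ≤ 2 * δ * (1 + b) := by
    intro l hl
    have hl0 : β l ≠ 0 := (Finset.mem_filter.1 hl).2
    obtain ⟨i, hil, hiS⟩ := exists_notMem (supp β) hcard (h.many l)
    have hβi : β i = 0 := by
      by_contra h0; exact hiS (Finset.mem_filter.2 ⟨Finset.mem_univ _, h0⟩)
    have hne : i ≠ l := by rintro rfl; exact hl0 hβi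
    have h1 := hβ.inner_le hl0 i
    rw [inner_sub_right, inner_sub_right, inner_synth_right, inner_synth_right] at h1
    have h2 : ∑ m, β m * inner ℝ (d i) (d m) ≤
        ∑ m, β m * inner ℝ (d l) (d m) + (2 * δ * b - η * β l) := by
      -- Termwise comparison: same-class Gram entries differ by at most `2 * δ`, except at `m = l`,
      -- where column `l` meets itself with inner product 1, at least `η` above the value of `c`.
      -- The term `m = i` has coefficient 0.
      have : 2 * δ * b - η * β l = ∑ m, (2 * δ * β m - if m = l then η * β m else 0) := by
        rw [Finset.sum_sub_distrib, Finset.sum_ite_eq' Finset.univ l, ← Finset.mul_sum]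
        simp [hb]
      rw [this, ← Finset.sum_add_distrib]
      refine Finset.sum_le_sum fun m _ => ?_
      have hm := hβ.nonneg m
      split_ifs with hml
      · subst hml
        have g1 := (abs_le.1 (h.gram i m hne)).2
        have g2 := h.self_le m
        rw [hil] at g1
        rw [real_inner_self_eq_norm_sq, h.unit]
        nlinarith
      · by_cases hmi : m = i
        · subst hmi; simp [hβi]
        · have g1 := (abs_le.1 (h.gram i m (Ne.symm hmi))).2
          have g2 := (abs_le.1 (h.gram l m (Ne.symm hml))).1
          rw [hil] at g1
          nlinarith
    have h3 := (abs_le.1 (h.corr i)).1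
    have h4 := (abs_le.1 (h.corr l)).2
    rw [hil] at h3
    linarith
  have hbs : η * b ≤ s * (2 * δ * (1 + b)) := by
    have : η * b = ∑ l ∈ supp β, η * β l := by rw [← Finset.mul_sum, sum_supp]
    rw [this]
    refine (Finset.sum_le_card_nsmul _ _ _ key).trans ?_
    rw [nsmul_eq_mul]
    exact mul_le_mul_of_nonneg_right (by exact_mod_cast hcard) (by positivity)
  have hsmall : 2 * s * δ ≤ η / 8 * η := by nlinarith
  have hδη : δ ≤ η / 16 := by nlinarith
  have hb4 : b ≤ η / 4 := by
    have h1 : η * b ≤ η / 8 * η * (1 + b) := by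
      nlinarith [mul_le_mul_of_nonneg_right hsmall (by linarith : 0 ≤ 1 + b)]
    have h2 : b ≤ η / 8 * (1 + b) := by
      by_contra! hc
      nlinarith
    nlinarith
  by_contra hjq
  obtain ⟨i, hi⟩ := h.exists_label_eq
  have h1 := hβ.inner_le hj i
  rw [inner_sub_right, inner_sub_right, inner_synth_right, inner_synth_right] at h1
  -- Inner products in `[0, 1]` suffice now: a wrong label would need `η ≤ 2 * δ + b ≤ η / 8 + η /
  -- 4`.
  have h2 : ∑ m, β m * inner ℝ (d i) (d m) ≤ b := by
    refine Finset.sum_le_sum fun m _ => ?_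
    exact mul_le_of_le_one_right (hβ.nonneg m) (h.inner_le_one i m)
  have h3 : 0 ≤ ∑ m, β m * inner ℝ (d j) (d m) :=
    Finset.sum_nonneg fun m _ => mul_nonneg (hβ.nonneg m) (h.inner_nonneg j m)
  have h4 := (abs_le.1 (h.corr i)).1
  have h5 := (abs_le.1 (h.corr j)).2
  rw [hi] at h4
  linarith [h.gap j hjq]

theorem l1_representation [DecidableEq ι] (h : IsSeparated d φ y q c s η δ)
    (hδ0 : 0 ≤ δ) (hη : 0 < η)
    (hη1 : η ≤ 1) (hδ : 16 * (s + 1) * δ ≤ η ^ 2) {β : ι → ℝ}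
    (hβ : IsL1Representation s d φ β) :
    (∀ j, β j ≠ 0 → y j = q) ∧ ‖φ - synth d β‖ < ‖φ‖ := by
  obtain ⟨⟨ε, -, hε, hmin⟩, hrep⟩ := hβ
  refine ⟨fun j hj => ?_, hmin.feasible.trans_lt hε⟩
  rcases hrep with hcard | ⟨-, hmax⟩
  · exact h.label_eq_of_l1_sparse hδ0 hη hη1 hδ hmin hcard hj
  · have hs0 : (0 : ℝ) ≤ s := Nat.cast_nonneg s
    exact h.label_eq_of_maximal (by nlinarith) fun i =>
      hmax j (Finset.mem_filter.2 ⟨Finset.mem_univ _, hj⟩) i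

/-- Choose the threshold reached by a tiny step `t` along a column best correlated with φ. A
minimizer has mass at most `t`, which changes correlations by less than any positive gap below the
maximum, so its support is maximal. It serves as the fallback if no sparse solution exists. -/
theorem exists_l1Representation [DecidableEq ι] (h : IsSeparated d φ y q c s η δ)
    (hη : 0 < η) (hδ : 2 * δ < η) :
    ∃ β, IsL1Representation s d φ β := by
  obtain ⟨i, hi⟩ := h.exists_label_eq
  have hne : (Finset.univ : Finset ι).Nonempty := ⟨i, Finset.mem_univ i⟩
  obtain ⟨m, -, hm⟩ := Finset.exists_max_image Finset.univ (fun j => inner ℝ (d j) φ) hne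
  have hm : ∀ j, inner ℝ (d j) φ ≤ inner ℝ (d m) φ := fun j => hm j (Finset.mem_univ j)
  have hmpos : 0 < inner ℝ (d m) φ := by
    have h1 := (abs_le.1 (h.corr i)).1
    rw [hi] at h1
    linarith [hm i, h.pos]
  have hgap : ∀ᶠ t : ℝ in 𝓝[>] 0, ∀ j, inner ℝ (d j) φ < inner ℝ (d m) φ →
      t < inner ℝ (d m) φ - inner ℝ (d j) φ := by
    refine eventually_all.2 fun j => ?_
    by_cases hj : inner ℝ (d j) φ < inner ℝ (d m) φ
    · filter_upwards [nhdsWithin_le_nhds (gt_mem_nhds (sub_pos.2 hj))] with t ht _ using ht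
    · exact Eventually.of_forall fun t ht => absurd ht hj
  obtain ⟨t, ⟨ht, htgap⟩, ht0⟩ := (((eventually_norm_sub_smul_lt hmpos).and hgap).and
    self_mem_nhdsWithin).exists
  have ht0 : 0 < t := ht0
  have hγ : ∀ l, 0 ≤ (t • Pi.single m 1 : ι → ℝ) l := by
    intro l
    rcases eq_or_ne l m with rfl | hl
    · simp [ht0.le]
    · simp [hl]
  have hγs : synth d (t • Pi.single m 1 : ι → ℝ) = t • d m := by rw [synth_smul, synth_single]
  obtain ⟨β, hβ⟩ := exists_isNonnegL1Min d φ hγ (ε := ‖φ - t • d m‖) (by rw [hγs])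
  have hsol : IsL1Solution d φ β := ⟨_, norm_nonneg _, ht, hβ⟩
  have hbt : ∑ l, β l ≤ t := by
    have := hβ.minimal _ hγ (by rw [hγs])
    rw [Finset.sum_congr rfl fun l _ => abs_of_nonneg (hβ.nonneg l),
      Finset.sum_congr rfl fun l _ => abs_of_nonneg (hγ l)] at this
    simpa [← Finset.mul_sum] using this
  have hmax : ∀ j ∈ supp β, ∀ i, inner ℝ (d i) φ ≤ inner ℝ (d j) φ := by
    intro j hj
    suffices inner ℝ (d m) φ ≤ inner ℝ (d j) φ from fun i => (hm i).trans this
    by_contra! hlt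
    have h1 := hβ.inner_le (Finset.mem_filter.1 hj).2 m
    rw [inner_sub_right, inner_sub_right, inner_synth_right, inner_synth_right] at h1
    have h2 : ∑ l, β l * inner ℝ (d m) (d l) ≤ ∑ l, β l :=
      Finset.sum_le_sum fun l _ => mul_le_of_le_one_right (hβ.nonneg l) (h.inner_le_one m l)
    have h3 : 0 ≤ ∑ l, β l * inner ℝ (d j) (d l) :=
      Finset.sum_nonneg fun l _ => mul_nonneg (hβ.nonneg l) (h.inner_nonneg j l)
    linarith [htgap j hlt]
  by_cases hex : ∃ β', IsL1Solution d φ β' ∧ (supp β').card ≤ s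
  · obtain ⟨β', h1, h2⟩ := hex
    exact ⟨β', h1, Or.inl h2⟩
  · push Not at hex
    exact ⟨β, hsol, Or.inr ⟨hex, hmax⟩⟩

/-- The coefficients of a least squares fit by few columns of class `q` do not add up to `1`. -/
theorem sum_lt_of_leastSquares [DecidableEq ι] (h : IsSeparated d φ y q c s η δ)
    (hs : 1 ≤ s) (hδ0 : 0 ≤ δ)
    (hη : 0 < η) (hη1 : η ≤ 1) (hδ : 16 * s * δ ≤ η) {S : Finset ι} (hcard : S.card ≤ s)
    (hS : ∀ j ∈ S, y j = q) {β : ι → ℝ} (hβ : IsNonnegLeastSquares d φ S β) :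
    ∑ j, β j < 1 - η / (8 * s) := by
  have hs1 : (1 : ℝ) ≤ s := by exact_mod_cast hs
  set b := ∑ l, β l with hb
  have hb0 : 0 ≤ b := Finset.sum_nonneg fun l _ => hβ.nonneg l
  have hlabel : ∀ j, β j ≠ 0 → y j = q := fun j hj => hS j (by
    by_contra h0; exact hj (hβ.supported j h0))
  have hsum : ∑ l ∈ S, β l = b :=
    Finset.sum_subset (Finset.subset_univ S) fun l _ hl => hβ.supported l hl
  -- Cauchy–Schwarz on at most `s` coefficients. Together with the diagonal excess `η` of the Gram
  -- matrix over `c q q`, it makes the fit longer than mass near 1 permits.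
  have hCS : b ^ 2 ≤ s * ∑ l, β l ^ 2 := by
    have h1 := sq_sum_le_card_mul_sum_sq (s := S) (f := β)
    rw [hsum] at h1
    refine h1.trans (mul_le_mul (by exact_mod_cast hcard) ?_ (by positivity) (by positivity))
    exact Finset.sum_le_sum_of_subset_of_nonneg (Finset.subset_univ S) fun _ _ _ => sq_nonneg _
  have hlow : (c q q - δ) * b ^ 2 + η * ∑ l, β l ^ 2 ≤ inner ℝ (synth d β) (synth d β) := by
    have hexp : (c q q - δ) * b ^ 2 + η * ∑ l, β l ^ 2 =
        ∑ l, β l * ((c q q - δ) * b + η * β l) := by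
      simp only [mul_add, Finset.sum_add_distrib, ← Finset.sum_mul, Finset.mul_sum, ← hb]
      congr 1
      · ring
      · exact Finset.sum_congr rfl fun l _ => by ring
    rw [hexp, inner_synth_left]
    refine Finset.sum_le_sum fun l _ => ?_
    by_cases hl0 : β l = 0
    · simp [hl0]
    rw [inner_synth_right]
    refine mul_le_mul_of_nonneg_left ?_ (hβ.nonneg l)
    have : η * β l = ∑ m, if m = l then η * β m else 0 := by simp
    rw [this, hb, Finset.mul_sum, ← Finset.sum_add_distrib]
    refine Finset.sum_le_sum fun m _ => ?_
    have hm := hβ.nonneg m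
    by_cases hm0 : β m = 0
    · simp [hm0]
    split_ifs with hml
    · subst hml
      rw [real_inner_self_eq_norm_sq, h.unit]
      nlinarith [h.self_test_le]
    · have := (abs_le.1 (h.gram l m (Ne.symm hml))).1
      rw [hlabel l hl0, hlabel m hm0] at this
      nlinarith
  have hup : inner ℝ (synth d β) φ ≤ (c q q + δ) * b := by
    rw [inner_synth_left, hb, Finset.mul_sum]
    refine Finset.sum_le_sum fun l _ => ?_
    by_cases hl0 : β l = 0
    · simp [hl0]
    have := (abs_le.1 (h.corr l)).2
    rw [hlabel l hl0] at this
    nlinarith [hβ.nonneg l]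
  have hopt := hβ.inner_synth_nonneg
  rw [inner_sub_right] at hopt
  have hc := h.self_test_le
  by_contra! hge
  -- If `b ≥ 1 - κ`, dividing the optimality inequality by `b` gives `η ≤ s * κ * (c q q - δ) + η *
  -- κ + 2 * s * δ`. Each term on the right is at most `η / 8`.
  set κ := η / (8 * s) with hκ
  have hκs : s * κ = η / 8 := by rw [hκ]; field_simp
  have hκ1 : κ ≤ 1 / 8 := by nlinarith
  have hκ0 : 0 < κ := by positivity
  have hbpos : 0 < b := by linarith
  have h1 : s * ((c q q - δ) * b ^ 2) + η * b ^ 2 ≤ s * ((c q q + δ) * b) := by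
    nlinarith
  have h2 : s * ((c q q - δ) * b) + η * b ≤ s * (c q q + δ) := by
    by_contra! h3
    nlinarith [mul_lt_mul_of_pos_right h3 hbpos]
  have hδ1 : δ ≤ η / 16 := by nlinarith
  have h3 : 0 ≤ s * (c q q - δ) + η := by
    have : 0 ≤ s * (c q q - δ) := mul_nonneg (by linarith) (by linarith [h.pos])
    linarith
  have h4 : (s * (c q q - δ) + η) * (1 - κ) ≤ s * (c q q + δ) := by nlinarith
  have h5 : s * κ * (c q q - δ) ≤ η / 8 := by
    rw [hκs]; nlinarith
  have h6 : η * κ ≤ η * (1 / 8) := mul_le_mul_of_nonneg_left hκ1 hη.le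
  nlinarith

/-- Up to errors of order δ, a column outside `S` of class `r` has correlation `c r q * (1 - b)`
with the residual. Since `1 - b` is bounded below, an unselected column of class `q` beats any
column of another class. -/
theorem label_eq_of_ompStep [DecidableEq ι] (h : IsSeparated d φ y q c s η δ)
    (hs : 1 ≤ s) (hδ0 : 0 ≤ δ)
    (hη : 0 < η) (hη1 : η ≤ 1) (hδ : 64 * s * δ ≤ η ^ 2) {S : Finset ι} (hcard : S.card ≤ s)
    (hS : ∀ j ∈ S, y j = q) {β : ι → ℝ} (hβ : IsNonnegLeastSquares d φ S β) {j : ι}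
    (hj : ∀ i, inner ℝ (d i) (φ - synth d β) ≤ inner ℝ (d j) (φ - synth d β)) : y j = q := by
  by_contra hjq
  have hs1 : (1 : ℝ) ≤ s := by exact_mod_cast hs
  have hjS : j ∉ S := fun hm => hjq (hS j hm)
  obtain ⟨i, hiq, hiS⟩ := exists_notMem S hcard h.many_test
  have hb := h.sum_lt_of_leastSquares hs hδ0 hη hη1 (by nlinarith) hcard hS hβ
  set b := ∑ l, β l with hbdef
  have hb0 : 0 ≤ b := Finset.sum_nonneg fun l _ => hβ.nonneg l
  have h1 := hj i
  rw [inner_sub_right, inner_sub_right, inner_synth_right, inner_synth_right] at h1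
  have h2 : ∑ l, β l * inner ℝ (d i) (d l) ≤ (c q q + δ) * b := by
    rw [hbdef, Finset.mul_sum]
    refine Finset.sum_le_sum fun l _ => ?_
    by_cases hl : l ∈ S
    · have := (abs_le.1 (h.gram i l (by rintro rfl; exact hiS hl))).2
      rw [hS l hl, hiq] at this
      nlinarith [hβ.nonneg l]
    · simp [hβ.supported l hl]
  have h3 : (c (y j) q - δ) * b ≤ ∑ l, β l * inner ℝ (d j) (d l) := by
    rw [hbdef, Finset.mul_sum]
    refine Finset.sum_le_sum fun l _ => ?_
    by_cases hl : l ∈ S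
    · have := (abs_le.1 (h.gram j l (by rintro rfl; exact hjS hl))).1
      rw [hS l hl] at this
      nlinarith [hβ.nonneg l]
    · simp [hβ.supported l hl]
  have h4 := (abs_le.1 (h.corr i)).1
  have h5 := (abs_le.1 (h.corr j)).2
  rw [hiq] at h4
  have h6 : (c q q - c (y j) q) * (1 - b) ≤ 2 * δ * (1 + b) := by nlinarith
  set κ := η / (8 * s) with hκ
  have hκs : s * κ = η / 8 := by rw [hκ]; field_simp
  have hκ0 : 0 < κ := by positivity
  -- Uses `κ < 1 - b` and `1 + b < 2`. Multiplied by `s`, it contradicts `64 * s * δ ≤ η ^ 2`, as `s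
  -- * κ = η / 8`.
  have h7 : η * κ < 4 * δ := by
    have := h.gap j hjq
    have : η * (1 - b) ≤ (c q q - c (y j) q) * (1 - b) :=
      mul_le_mul_of_nonneg_right (by linarith) (by linarith)
    nlinarith
  nlinarith

/-- The induction invariant. The initial state is itself the fit over the empty set, so the first
selection needs no separate treatment. -/
theorem ompState [DecidableEq ι] (h : IsSeparated d φ y q c s η δ) (hs : 1 ≤ s) (hδ0 : 0 ≤ δ)
    (hη : 0 < η) (hη1 : η ≤ 1) (hδ : 64 * s * δ ≤ η ^ 2) {t : ℕ} {S : Finset ι} {β : ι → ℝ}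
    (hst : OMPState d φ t S β) (ht : t ≤ s) :
    S.card ≤ t ∧ (∀ j ∈ S, y j = q) ∧ IsNonnegLeastSquares d φ S β ∧
      (1 ≤ t → ‖φ - synth d β‖ < ‖φ‖) := by
  have hs1 : (1 : ℝ) ≤ s := by exact_mod_cast hs
  induction hst with
  | start =>
    refine ⟨by simp, by simp, ⟨by simp, by simp, fun β' _ h2 => ?_⟩, by simp⟩
    have : β' = 0 := by ext j; exact h2 j (by simp)
    rw [this]
  | @select t S β j β' hst hpos hmax hβ' ih =>
    obtain ⟨h1, h2, h3, h4⟩ := ih (by omega)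
    have hjq := h.label_eq_of_ompStep hs hδ0 hη hη1 hδ (h1.trans (by omega)) h2 h3 hmax
    refine ⟨(Finset.card_insert_le _ _).trans (by omega), ?_, hβ', fun _ => ?_⟩
    · simpa [hjq] using h2
    · refine (hβ'.norm_lt h3.nonneg h3.supported hpos).trans_le ?_
      simpa [synth_zero] using h3.minimal 0 (by simp) (by simp)
  | @halt t S β hst hle ih =>
    obtain ⟨h1, h2, h3, h4⟩ := ih (by omega)
    refine ⟨by omega, h2, h3, fun _ => ?_⟩
    rcases Nat.eq_zero_or_pos t with rfl | htpos
    -- Halting at once is impossible: a column of class `q` has correlation at least `η - δ > 0`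
    -- with φ.
    · exfalso
      have hS : S = ∅ := Finset.card_eq_zero.1 (by omega)
      have hβ0 : β = 0 := by ext j; exact h3.supported j (by simp [hS])
      obtain ⟨i, hi⟩ := h.exists_label_eq
      have h5 := hle i
      rw [hβ0, synth_zero, sub_zero] at h5
      have h6 := (abs_le.1 (h.corr i)).1
      rw [hi] at h6
      nlinarith [h.pos]
    · exact h4 htpos

theorem omp_representation [DecidableEq ι] (h : IsSeparated d φ y q c s η δ)
    (hs : 1 ≤ s) (hδ0 : 0 ≤ δ)
    (hη : 0 < η) (hη1 : η ≤ 1) (hδ : 64 * s * δ ≤ η ^ 2) {β : ι → ℝ}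
    (hβ : IsOMPRepresentation s d φ β) :
    (∀ j, β j ≠ 0 → y j = q) ∧ ‖φ - synth d β‖ < ‖φ‖ := by
  obtain ⟨S, hS⟩ := hβ
  obtain ⟨-, h2, h3, h4⟩ := h.ompState hs hδ0 hη hη1 hδ hS le_rfl
  exact ⟨fun j hj => h2 j (by by_contra h0; exact hj (h3.supported j h0)), h4 hs⟩

theorem exists_ompState [DecidableEq ι] (h : IsSeparated d φ y q c s η δ) (t : ℕ) :
    ∃ S β, OMPState d φ t S β := by
  induction t with
  | zero => exact ⟨∅, 0, .start⟩
  | succ t ih =>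
    obtain ⟨S, β, hst⟩ := ih
    by_cases hle : ∀ i, inner ℝ (d i) (φ - synth d β) ≤ 0
    · exact ⟨S, β, .halt hst hle⟩
    · push Not at hle
      obtain ⟨i, hi⟩ := hle
      obtain ⟨m, -, hm⟩ := Finset.exists_max_image Finset.univ
        (fun j => inner ℝ (d j) (φ - synth d β)) ⟨i, Finset.mem_univ i⟩
      have hm : ∀ j, inner ℝ (d j) (φ - synth d β) ≤ inner ℝ (d m) (φ - synth d β) :=
        fun j => hm j (Finset.mem_univ j)
      obtain ⟨β', hβ'⟩ := exists_isNonnegLeastSquares h.unit h.inner_nonneg φ (insert m S)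
      exact ⟨insert m S, β', .select m β' hst (hi.trans_le (hm i)) hm hβ'⟩

end IsSeparated

end Separated

/-! ### Two vertices of the blockmodel seen from the others -/

/-- Each `v ≠ i` forms one ordered pair with `i`: the first product collects the `v` above `i`, the
second those below. -/
theorem prod_Ioi_ite_mul_prod_Ioi_ite {N : ℕ} {i : Fin N} {H : Fin N → ℝ} (hH : H i = 1) :
    (∏ u, ∏ v ∈ Finset.Ioi u, if u = i then H v else 1) *
      (∏ u, ∏ v ∈ Finset.Ioi u, if v = i then H u else 1) = ∏ v, H v := by
  have h1 : (∏ u, ∏ v ∈ Finset.Ioi u, if u = i then H v else 1) =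
      ∏ v, if i < v then H v else 1 := by
    rw [Finset.prod_eq_single i (fun u _ hu => by simp [hu]) (by simp)]
    simp [← Finset.prod_filter, Finset.filter_lt_eq_Ioi]
  have h2 : (∏ u, ∏ v ∈ Finset.Ioi u, if v = i then H u else 1) =
      ∏ u, if u < i then H u else 1 := by
    refine Finset.prod_congr rfl fun u _ => ?_
    rw [Finset.prod_ite_eq']
    simp
  rw [h1, h2, ← Finset.prod_mul_distrib]
  refine Finset.prod_congr rfl fun v _ => ?_
  rcases lt_trichotomy v i with h | rfl | h
  · simp [h, h.not_gt]
  · simp [hH]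
  · simp [h, h.not_gt]

/-- A product over pairs of vertices whose only nontrivial factors join `i` or `j` to the others. -/
theorem prod_Ioi_eq_prod_pair {N : ℕ} {i j : Fin N} (hij : i ≠ j) {G : Fin N → Fin N → ℝ}
    (hsymm : ∀ u v, G u v = G v u) (hG : G i j = 1)
    (hone : ∀ u v, u ≠ i → u ≠ j → v ≠ i → v ≠ j → G u v = 1) :
    ∏ u, ∏ v ∈ Finset.Ioi u, G u v =
      ∏ k, if k ≠ i ∧ k ≠ j then G i k * G j k else 1 := by
  -- Trivial at both `i` and `j`, so the products around `i` and around `j` share no factor.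
  let H : Fin N → Fin N → ℝ := fun a v => if v ≠ i ∧ v ≠ j then G a v else 1
  have h1 := prod_Ioi_ite_mul_prod_Ioi_ite (i := i) (H := H i) (by simp [H])
  have h2 := prod_Ioi_ite_mul_prod_Ioi_ite (i := j) (H := H j) (by simp [H])
  have h3 : ∏ k, (if k ≠ i ∧ k ≠ j then G i k * G j k else 1) = (∏ k, H i k) * ∏ k, H j k := by
    rw [← Finset.prod_mul_distrib]
    refine Finset.prod_congr rfl fun k _ => ?_
    simp only [H]
    split_ifs <;> simp
  rw [h3, ← h1, ← h2]
  simp only [← Finset.prod_mul_distrib]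
  refine Finset.prod_congr rfl fun u _ => Finset.prod_congr rfl fun v hv => ?_
  have huv : u ≠ v := (Finset.mem_Ioi.1 hv).ne
  have hG' : G j i = 1 := by rw [hsymm, hG]
  simp only [H]
  by_cases hui : u = i
  · subst hui
    by_cases hvj : v = j
    · subst hvj; simp [hij, hij.symm, hG]
    · simp [hij, hvj, huv.symm]
  · by_cases huj : u = j
    · subst huj
      by_cases hvi : v = i
      · subst hvi; simp [hij, hij.symm, hG']
      · simp [hij.symm, hvi, huv.symm]
    · by_cases hvi : v = i
      · subst hvi
        simp [hui, huj, hij, hsymm u v]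
      · by_cases hvj : v = j
        · subst hvj
          simp [hui, huj, hij.symm, hsymm u v]
        · simp [hui, huj, hvi, hvj, hone]

/-- The weight of `b` under the Bernoulli law with parameter `x`. -/
def bern (x : ℝ) (b : Bool) : ℝ := if b then x else 1 - x

theorem bern_nonneg {x : ℝ} (hx : x ∈ Set.Icc (0 : ℝ) 1) (b : Bool) : 0 ≤ bern x b := by
  unfold bern; split_ifs <;> linarith [hx.1, hx.2]

theorem sum_bern (x : ℝ) : ∑ b, bern x b = 1 := by simp [bern]

/-! ### Joint law of labels and edges -/

section Law

variable {Ω : Type*} [MeasurableSpace Ω] {μ : Measure Ω} [IsProbabilityMeasure μ] {K : ℕ}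
  {prior : Fin K → ℝ} {B : Matrix (Fin K) (Fin K) ℝ} {Y : ℕ → Ω → Fin K} {A : ℕ → ℕ → Ω → Bool}

/-- The probability that the labels are prescribed and the edges are restricted one by one. -/
theorem IsSBM.measureReal_cylinder (h : IsSBM μ prior B Y A) {N : ℕ} (y : Fin N → Fin K)
    (τ : Fin N → Fin N → Finset Bool) :
    μ.real {ω | (∀ u : Fin N, Y u ω = y u) ∧ ∀ u v : Fin N, u < v → A u v ω ∈ τ u v} =
      (∏ u, prior (y u)) *
        ∏ u, ∏ v ∈ Finset.Ioi u, ∑ b ∈ τ u v, bern (B (y u) (y v)) b := by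
  -- `X` keeps only the upper triangle, so each graph is counted once; `a` restores the symmetric
  -- hollow matrix that `law` requires.
  let X : Ω → Fin N × Fin N → Bool := fun ω p => if p.1 < p.2 then A p.1 p.2 ω else false
  let t : Fin N × Fin N → Finset Bool := fun p => if p.1 < p.2 then τ p.1 p.2 else {false}
  let a : (Fin N × Fin N → Bool) → Fin N → Fin N → Bool := fun x u v =>
    if u < v then x (u, v) else if v < u then x (v, u) else false
  have hX : Measurable X := by
    refine measurable_pi_lambda _ fun p => ?_
    by_cases hp : p.1 < p.2
    · simpa [X, hp] using h.measurable_adj _ _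
    · simp [X, hp]
  have hYm : MeasurableSet {ω | ∀ u : Fin N, Y u ω = y u} := by
    simp only [Set.ofPred_forall]
    exact MeasurableSet.iInter fun u => h.measurable_label u (MeasurableSet.singleton (y u))
  have hunion : {ω | (∀ u : Fin N, Y u ω = y u) ∧ ∀ u v : Fin N, u < v → A u v ω ∈ τ u v} =
      ⋃ x ∈ Fintype.piFinset t, ({ω | ∀ u : Fin N, Y u ω = y u} ∩ X ⁻¹' {x}) := by
    ext ω
    simp only [Set.mem_ofPred_eq, Set.mem_iUnion, Set.mem_inter_iff, Set.mem_preimage,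
      Set.mem_singleton_iff, Fintype.mem_piFinset, exists_prop]
    constructor
    · rintro ⟨h1, h2⟩
      refine ⟨X ω, fun p => ?_, h1, rfl⟩
      by_cases hp : p.1 < p.2
      · simpa [X, t, hp] using h2 _ _ hp
      · simp [X, t, hp]
    · rintro ⟨x, hx, h1, rfl⟩
      refine ⟨h1, fun u v huv => ?_⟩
      simpa [X, t, huv] using hx (u, v)
  have hterm : ∀ x ∈ Fintype.piFinset t,
      μ.real ({ω | ∀ u : Fin N, Y u ω = y u} ∩ X ⁻¹' {x}) =
      (∏ u, prior (y u)) *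
        ∏ p : Fin N × Fin N, if p.1 < p.2 then bern (B (y p.1) (y p.2)) (x p) else 1 := by
    intro x hx
    have hsymm : ∀ u v, a x u v = a x v u := by
      intro u v
      simp only [a]
      rcases lt_trichotomy u v with huv | rfl | huv
      · simp [huv, huv.not_gt]
      · rfl
      · simp [huv, huv.not_gt]
    have hset : {ω | ∀ u : Fin N, Y u ω = y u} ∩ X ⁻¹' {x} =
        {ω | (∀ u : Fin N, Y u ω = y u) ∧ ∀ u v : Fin N, A u v ω = a x u v} := by
      ext ω
      simp only [Set.mem_ofPred_eq, Set.mem_inter_iff, Set.mem_preimage, Set.mem_singleton_iff,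
        and_congr_right_iff]
      intro _
      constructor
      · rintro rfl u v
        rcases lt_trichotomy u v with huv | rfl | huv
        · simp [a, X, huv]
        · simp [a, h.hollow]
        · simp [a, X, huv, huv.not_gt, h.symm u v]
      · intro hA
        ext p
        by_cases hp : p.1 < p.2
        · simp [X, hp, hA, a]
        · have := (Fintype.mem_piFinset.1 hx) p
          simp only [t, hp, if_false, Finset.mem_singleton] at this
          simp [X, hp, this]
    rw [hset, h.law N y (a x) hsymm (by simp [a])]
    congr 1
    rw [Fintype.prod_prod_type]
    refine Finset.prod_congr rfl fun u _ => ?_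
    rw [← Finset.prod_filter, Finset.filter_lt_eq_Ioi]
    refine Finset.prod_congr rfl fun v hv => ?_
    simp [a, Finset.mem_Ioi.1 hv, bern]
  -- Distributivity turns the sum over graphs of edge products into a product of sums over the
  -- allowed values of each edge.
  rw [hunion, measureReal_biUnion_finset, Finset.sum_congr rfl hterm, ← Finset.mul_sum,
    ← Finset.prod_univ_sum t
      (fun p b => if p.1 < p.2 then bern (B (y p.1) (y p.2)) b else 1)]
  · congr 1
    rw [Fintype.prod_prod_type]
    refine Finset.prod_congr rfl fun u _ => ?_
    rw [← Finset.filter_lt_eq_Ioi, Finset.prod_filter]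
    refine Finset.prod_congr rfl fun v _ => ?_
    by_cases huv : u < v <;> simp [t, huv]
  · intro x _ x' _ hne
    refine Set.disjoint_left.2 fun ω h1 h2 => hne ?_
    exact h1.2.symm.trans h2.2
  · exact fun x _ => hYm.inter (hX (MeasurableSet.singleton x))

/-- The law of the label of a vertex and of its edges to two vertices of classes `q` and `r`. -/
def pairWeight (prior : Fin K → ℝ) (B : Matrix (Fin K) (Fin K) ℝ) (q r : Fin K)
    (z : Fin K × Bool × Bool) : ℝ :=
  prior z.1 * (bern (B z.1 q) z.2.1 * bern (B z.1 r) z.2.2)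

/-- Given the labels of `i` and `j`, what the other vertices see of them is independent. -/
theorem IsSBM.measureReal_pair (h : IsSBM μ prior B Y A) (hB : B.IsSymm) {N : ℕ} {i j : Fin N}
    (hij : i ≠ j) (q r : Fin K) (z : {k : Fin N // k ≠ i ∧ k ≠ j} → Fin K × Bool × Bool) :
    μ.real {ω | Y i ω = q ∧ Y j ω = r ∧
        ∀ k : {k : Fin N // k ≠ i ∧ k ≠ j}, (Y k ω, A k i ω, A k j ω) = z k} =
      prior q * prior r * ∏ k, pairWeight prior B q r (z k) := by
  let z' : Fin N → Fin K × Bool × Bool := fun k =>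
    if hk : k ≠ i ∧ k ≠ j then z ⟨k, hk⟩ else (q, false, false)
  let y : Fin N → Fin K := fun u => if u = i then q else if u = j then r else (z' u).1
  -- The edge `{i, j}` and the edges among the other vertices are left free; their Bernoulli weights
  -- sum to 1. The default value of `z'` at `i` and `j` never enters the probability.
  let τ : Fin N → Fin N → Finset Bool := fun u v =>
    if u = i then (if v = j then Finset.univ else {(z' v).2.1})
    else if u = j then (if v = i then Finset.univ else {(z' v).2.2})
    else if v = i then {(z' u).2.1} else if v = j then {(z' u).2.2} else Finset.univ
  have hz : ∀ k : {k : Fin N // k ≠ i ∧ k ≠ j}, z' k = z k := fun k => by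
    simp only [z', dif_pos k.2, Subtype.coe_eta]
  have hset : {ω | Y i ω = q ∧ Y j ω = r ∧
      ∀ k : {k : Fin N // k ≠ i ∧ k ≠ j}, (Y k ω, A k i ω, A k j ω) = z k} =
      {ω | (∀ u : Fin N, Y u ω = y u) ∧ ∀ u v : Fin N, u < v → A u v ω ∈ τ u v} := by
    ext ω
    simp only [Set.mem_ofPred_eq]
    constructor
    · rintro ⟨h1, h2, h3⟩
      have h3 : ∀ k, k ≠ i → k ≠ j → (Y k ω, A k i ω, A k j ω) = z' k := fun k h h' =>
        (h3 ⟨k, h, h'⟩).trans (hz ⟨k, h, h'⟩).symm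
      refine ⟨fun u => ?_, fun u v huv => ?_⟩
      · by_cases hui : u = i
        · simp [y, hui, h1]
        · by_cases huj : u = j
          · simp [y, huj, hij.symm, h2]
          · simp [y, hui, huj, ← h3 u hui huj]
      · by_cases hui : u = i
        · subst hui
          by_cases hvj : v = j
          · simp [τ, hvj]
          · simp [τ, hvj, ← h3 v huv.ne' hvj, h.symm v u]
        · by_cases huj : u = j
          · subst huj
            by_cases hvi : v = i
            · simp [τ, hvi, hui]
            · simp [τ, hui, hvi, ← h3 v hvi huv.ne', h.symm v u]
          · by_cases hvi : v = i
            · simp [τ, hui, huj, hvi, ← h3 u hui huj]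
            · by_cases hvj : v = j
              · simp [τ, hui, huj, hvj, hij.symm, ← h3 u hui huj]
              · simp [τ, hui, huj, hvi, hvj]
    · rintro ⟨h1, h2⟩
      refine ⟨by simpa [y] using h1 i, by simpa [y, hij.symm] using h1 j, fun ⟨k, hki, hkj⟩ => ?_⟩
      rw [← hz]
      refine Prod.ext (by simpa [y, hki, hkj] using h1 k) (Prod.ext ?_ ?_)
      · rcases lt_or_gt_of_ne hki with hlt | hlt
        · simpa [τ, hki, hkj] using h2 k i hlt
        · have := h2 i k hlt
          simp only [τ, hkj, if_true, if_false, Finset.mem_singleton] at this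
          simpa [h.symm k i] using this
      · rcases lt_or_gt_of_ne hkj with hlt | hlt
        · simpa [τ, hki, hkj, hij.symm] using h2 k j hlt
        · have := h2 j k hlt
          simp only [τ, hij.symm, hki, if_true, if_false, Finset.mem_singleton] at this
          simpa [h.symm k j] using this
  rw [hset, h.measureReal_cylinder, prod_Ioi_eq_prod_pair hij]
  · have h1 : ∏ u, prior (y u) = prior q * prior r *
        ∏ u, if u ≠ i ∧ u ≠ j then prior (z' u).1 else 1 := by
      have : ∀ u, prior (y u) = (if u = i then prior q else 1) * (if u = j then prior r else 1) *
          (if u ≠ i ∧ u ≠ j then prior (z' u).1 else 1) := by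
        intro u
        by_cases hui : u = i
        · simp [y, hui, hij]
        · by_cases huj : u = j
          · simp [y, huj, hij.symm]
          · simp [y, hui, huj]
      simp only [this, Finset.prod_mul_distrib, Finset.prod_ite_eq', Finset.mem_univ, if_true]
    rw [h1, mul_assoc, ← Finset.prod_mul_distrib]
    congr 1
    have h2 : ∏ k, pairWeight prior B q r (z k) =
        ∏ k : {k : Fin N // k ≠ i ∧ k ≠ j}, pairWeight prior B q r (z' k) :=
      Finset.prod_congr rfl fun k _ => by rw [hz]
    rw [h2, ← Finset.prod_subtype (Finset.univ.filter fun k => k ≠ i ∧ k ≠ j) (by simp)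
      (fun k => pairWeight prior B q r (z' k)), Finset.prod_filter]
    refine Finset.prod_congr rfl fun k _ => ?_
    by_cases hk : k ≠ i ∧ k ≠ j
    · simp only [if_pos hk]
      simp [τ, y, hk.1, hk.2, hij.symm, pairWeight, hB.apply]
    · simp [if_neg hk]
  · intro u v
    have hτ : τ u v = τ v u := by
      simp only [τ]
      by_cases hui : u = i <;> by_cases huj : u = j <;> by_cases hvi : v = i <;>
        by_cases hvj : v = j <;> simp_all
    rw [hτ, hB.apply]
  · simp [τ, bern]
  · intro u v hui huj hvi hvj
    simp [τ, hui, huj, hvi, hvj, bern]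

end Law

/-- An exponential bound for sums of independent centered variables with values in `[-1, 1]`. -/
theorem sum_prod_le_exp {ι α : Type*} [Fintype ι] [Fintype α] [DecidableEq ι] {p X : α → ℝ}
    (hp : ∀ a, 0 ≤ p a) (hp1 : ∑ a, p a = 1) (hX : ∀ a, |X a| ≤ 1) (hmean : ∑ a, p a * X a = 0)
    {δ : ℝ} (hδ0 : 0 ≤ δ) (hδ1 : δ ≤ 1) :
    ∑ z : ι → α with δ * Fintype.card ι ≤ ∑ k, X (z k), ∏ k, p (z k) ≤
      Real.exp (-(Fintype.card ι * δ ^ 2 / 4)) := by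
  set m : ℝ := (Fintype.card ι : ℝ) with hm
  -- Chernoff with parameter `δ / 2`: `exp x ≤ 1 + x + x ^ 2` for `|x| ≤ 1`, and the linear term has
  -- mean 0. The exponent per variable is `-δ ^ 2 / 2 + δ ^ 2 / 4`.
  have hmgf : ∑ a, p a * Real.exp (δ / 2 * X a) ≤ Real.exp ((δ / 2) ^ 2) := by
    calc ∑ a, p a * Real.exp (δ / 2 * X a)
        ≤ ∑ a, (p a + δ / 2 * (p a * X a) + (δ / 2) ^ 2 * p a) := by
          refine Finset.sum_le_sum fun a _ => ?_
          have hsmall : |δ / 2 * X a| ≤ 1 := by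
            rw [abs_mul, abs_of_nonneg (by linarith)]
            nlinarith [hX a, abs_nonneg (X a)]
          have h1 := (abs_le.1 (Real.abs_exp_sub_one_sub_id_le hsmall)).2
          have h2 : X a ^ 2 ≤ 1 := (sq_le_one_iff_abs_le_one _).2 (hX a)
          have h3 : (δ / 2) ^ 2 * X a ^ 2 ≤ (δ / 2) ^ 2 * 1 :=
            mul_le_mul_of_nonneg_left h2 (sq_nonneg _)
          nlinarith [hp a]
      _ = 1 + (δ / 2) ^ 2 := by
          simp only [Finset.sum_add_distrib, ← Finset.mul_sum, hp1, hmean]; ring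
      _ ≤ _ := by linarith [Real.add_one_le_exp ((δ / 2) ^ 2)]
  calc ∑ z : ι → α with δ * m ≤ ∑ k, X (z k), ∏ k, p (z k)
      ≤ ∑ z : ι → α with δ * m ≤ ∑ k, X (z k),
          Real.exp (-(δ / 2 * (δ * m))) * ∏ k, (p (z k) * Real.exp (δ / 2 * X (z k))) := by
        refine Finset.sum_le_sum fun z hz => ?_
        have hz := (Finset.mem_filter.1 hz).2
        rw [Finset.prod_mul_distrib, ← Real.exp_sum, mul_left_comm, ← Real.exp_add,
          ← Finset.mul_sum]
        refine le_mul_of_one_le_right (Finset.prod_nonneg fun k _ => hp _) (Real.one_le_exp ?_)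
        nlinarith
    _ ≤ ∑ z : ι → α,
          Real.exp (-(δ / 2 * (δ * m))) * ∏ k, (p (z k) * Real.exp (δ / 2 * X (z k))) := by
        refine Finset.sum_le_sum_of_subset_of_nonneg (Finset.filter_subset _ _) fun z _ _ => ?_
        exact mul_nonneg (Real.exp_pos _).le
          (Finset.prod_nonneg fun k _ => mul_nonneg (hp _) (Real.exp_pos _).le)
    _ = Real.exp (-(δ / 2 * (δ * m))) * (∑ a, p a * Real.exp (δ / 2 * X a)) ^
          Fintype.card ι := by
        rw [← Finset.mul_sum, ← Finset.card_univ, ← Finset.prod_const, Finset.prod_univ_sum,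
          Fintype.piFinset_univ]
    _ ≤ Real.exp (-(δ / 2 * (δ * m))) * Real.exp ((δ / 2) ^ 2) ^ Fintype.card ι := by
        refine mul_le_mul_of_nonneg_left (pow_le_pow_left₀ ?_ hmgf _) (Real.exp_pos _).le
        exact Finset.sum_nonneg fun a _ => mul_nonneg (hp _) (Real.exp_pos _).le
    _ = _ := by
        rw [← Real.exp_nat_mul, ← Real.exp_add, ← hm]
        congr 1; ring

section Deviation

variable {Ω : Type*} [MeasurableSpace Ω] {μ : Measure Ω} [IsProbabilityMeasure μ] {K : ℕ}
  {prior : Fin K → ℝ} {B : Matrix (Fin K) (Fin K) ℝ} {Y : ℕ → Ω → Fin K} {A : ℕ → ℕ → Ω → Bool}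

theorem pairWeight_nonneg (hprior : prior ∈ stdSimplex ℝ (Fin K))
    (hB : ∀ k l, B k l ∈ Set.Icc (0 : ℝ) 1) (q r : Fin K) (z : Fin K × Bool × Bool) :
    0 ≤ pairWeight prior B q r z :=
  mul_nonneg (hprior.1 _) (mul_nonneg (bern_nonneg (hB _ _) _) (bern_nonneg (hB _ _) _))

theorem sum_pairWeight_mul (q r : Fin K) (X : Fin K × Bool × Bool → ℝ) :
    ∑ z, pairWeight prior B q r z * X z = ∑ k, prior k * ∑ b, ∑ b',
      bern (B k q) b * bern (B k r) b' * X (k, b, b') := by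
  simp only [Fintype.sum_prod_type, pairWeight, Finset.mul_sum, mul_assoc]

theorem sum_pairWeight (hprior : prior ∈ stdSimplex ℝ (Fin K)) (q r : Fin K) :
    ∑ z, pairWeight prior B q r z = 1 := by
  have := sum_pairWeight_mul (prior := prior) (B := B) q r (fun _ => 1)
  simp only [mul_one] at this
  rw [this, ← hprior.2]
  refine Finset.sum_congr rfl fun k _ => ?_
  simp only [← Finset.mul_sum, sum_bern, mul_one]

/-- Averages of what the other vertices see of two vertices concentrate. -/
theorem IsSBM.measureReal_deviation_le (h : IsSBM μ prior B Y A)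
    (hprior : prior ∈ stdSimplex ℝ (Fin K)) (hBs : B.IsSymm)
    (hB : ∀ k l, B k l ∈ Set.Icc (0 : ℝ) 1) {N : ℕ} {i j : Fin N} (hij : i ≠ j) (q r : Fin K)
    {X : Fin K × Bool × Bool → ℝ} (hX : ∀ z, X z ∈ Set.Icc (0 : ℝ) 1)
    {δ : ℝ} (hδ0 : 0 ≤ δ) (hδ1 : δ ≤ 1) :
    μ.real {ω | Y i ω = q ∧ Y j ω = r ∧ δ * (N - 2 : ℕ) ≤
        |∑ k : {k : Fin N // k ≠ i ∧ k ≠ j}, (X (Y k ω, A k i ω, A k j ω) -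
          ∑ z, pairWeight prior B q r z * X z)|} ≤
      prior q * prior r * (2 * Real.exp (-((N - 2 : ℕ) * δ ^ 2 / 4))) := by
  classical
  set m := ∑ z, pairWeight prior B q r z * X z with hm
  have hp := pairWeight_nonneg hprior hB q r
  have hp1 := sum_pairWeight (B := B) hprior q r
  have hm0 : 0 ≤ m := Finset.sum_nonneg fun z _ => mul_nonneg (hp z) (hX z).1
  have hm1 : m ≤ 1 := by
    rw [hm, ← hp1]
    exact Finset.sum_le_sum fun z _ => mul_le_of_le_one_right (hp z) (hX z).2
  have hcard : Fintype.card {k : Fin N // k ≠ i ∧ k ≠ j} = N - 2 := by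
    rw [Fintype.card_subtype]
    have : (Finset.univ.filter fun k : Fin N => k ≠ i ∧ k ≠ j) =
        (Finset.univ.erase i).erase j := by
      ext k; simp [and_comm]
    rw [this, Finset.card_erase_of_mem (by simp [hij.symm]), Finset.card_erase_of_mem (by simp),
      Finset.card_univ, Fintype.card_fin]
    omega
  let κ := {k : Fin N // k ≠ i ∧ k ≠ j}
  have hup := sum_prod_le_exp (ι := κ) (X := fun z => X z - m) hp hp1
    (fun z => abs_le.2 ⟨by linarith [(hX z).1], by linarith [(hX z).2]⟩)
    (by simp only [mul_sub, Finset.sum_sub_distrib, ← Finset.sum_mul, hp1]; linarith) hδ0 hδ1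
  have hdown := sum_prod_le_exp (ι := κ) (X := fun z => m - X z) hp hp1
    (fun z => abs_le.2 ⟨by linarith [(hX z).2], by linarith [(hX z).1]⟩)
    (by simp only [mul_sub, Finset.sum_sub_distrib, ← Finset.sum_mul, hp1]; linarith) hδ0 hδ1
  rw [hcard] at hup hdown
  let T₁ : Finset (κ → Fin K × Bool × Bool) := {z | δ * (N - 2 : ℕ) ≤ ∑ k, (X (z k) - m)}
  let T₂ : Finset (κ → Fin K × Bool × Bool) := {z | δ * (N - 2 : ℕ) ≤ ∑ k, (m - X (z k))}
  have hsub : {ω | Y i ω = q ∧ Y j ω = r ∧ δ * (N - 2 : ℕ) ≤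
        |∑ k : κ, (X (Y k ω, A k i ω, A k j ω) - m)|} ⊆
      ⋃ z ∈ T₁ ∪ T₂, {ω | Y i ω = q ∧ Y j ω = r ∧
        ∀ k : κ, (Y k ω, A k i ω, A k j ω) = z k} := by
    rintro ω ⟨h1, h2, h3⟩
    simp only [Set.mem_iUnion, exists_prop]
    refine ⟨fun k => (Y k ω, A k i ω, A k j ω), ?_, h1, h2, fun k => rfl⟩
    rw [Finset.mem_union, Finset.mem_filter, Finset.mem_filter]
    rcases le_abs.1 h3 with h4 | h4
    · exact Or.inl ⟨Finset.mem_univ _, h4⟩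
    · refine Or.inr ⟨Finset.mem_univ _, ?_⟩
      rw [← Finset.sum_neg_distrib] at h4
      simpa using h4
  refine (measureReal_mono hsub (measure_ne_top μ _)).trans ((measureReal_biUnion_finset_le _ _).trans ?_)
  -- The factor `prior q * prior r` is kept: it sums to 1 in the union bound, and it shows that
  -- labels of prior 0 almost surely do not occur.
  rw [Finset.sum_congr rfl fun z _ => h.measureReal_pair hBs hij q r z, ← Finset.mul_sum]
  refine mul_le_mul_of_nonneg_left ?_ (mul_nonneg (hprior.1 _) (hprior.1 _))
  have hle : ∑ z ∈ T₁ ∪ T₂, ∏ k, pairWeight prior B q r (z k) ≤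
      ∑ z ∈ T₁, ∏ k, pairWeight prior B q r (z k) +
        ∑ z ∈ T₂, ∏ k, pairWeight prior B q r (z k) := by
    rw [← Finset.sum_union_inter]
    exact le_add_of_nonneg_right
      (Finset.sum_nonneg fun z _ => Finset.prod_nonneg fun k _ => hp _)
  linarith

end Deviation

/-! ### Typical graphs -/

section Typical

variable {Ω : Type*} {K : ℕ}
  {prior : Fin K → ℝ} {B : Matrix (Fin K) (Fin K) ℝ} {Y : ℕ → Ω → Fin K} {A : ℕ → ℕ → Ω → Bool}

/-- What a vertex sees of two others: whether it is a common neighbor, whether it is a neighbor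
of the first one, and whether its own label is `m`. -/
def observable : Option (Option (Fin K)) → Fin K × Bool × Bool → ℝ
  | none, z => if z.2.1 ∧ z.2.2 then 1 else 0
  | some none, z => if z.2.1 then 1 else 0
  | some (some m), z => if z.1 = m then 1 else 0

theorem observable_mem (o : Option (Option (Fin K))) (z : Fin K × Bool × Bool) :
    observable o z ∈ Set.Icc (0 : ℝ) 1 := by
  rcases o with _ | _ | m <;> simp only [observable] <;> split_ifs <;> simp

/-- The mean of an observable for two vertices of classes `q` and `r`. -/
def observableMean (prior : Fin K → ℝ) (B : Matrix (Fin K) (Fin K) ℝ) (q r : Fin K)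
    (o : Option (Option (Fin K))) : ℝ :=
  ∑ z, pairWeight prior B q r z * observable o z

theorem observableMean_common (q r : Fin K) :
    observableMean prior B q r none = labelExp prior (blockVar B q * blockVar B r) := by
  rw [observableMean, sum_pairWeight_mul, labelExp]
  simp [observable, bern, blockVar]

theorem observableMean_edge (q r : Fin K) :
    observableMean prior B q r (some none) = labelExp prior (blockVar B q) := by
  rw [observableMean, sum_pairWeight_mul, labelExp]
  refine Finset.sum_congr rfl fun k _ => ?_
  simp [observable, bern, blockVar, ← mul_add]

theorem observableMean_label (q r m : Fin K) :
    observableMean prior B q r (some (some m)) = prior m := by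
  rw [observableMean, sum_pairWeight_mul, Finset.sum_eq_single m]
  · simp only [observable, if_true, mul_one, ← Finset.mul_sum, sum_bern]
  · intro k _ hk
    simp [observable, hk]
  · simp

/-- In the graph on the vertices `0, …, n`, the averages of all observables are nearly their
means, for every pair of vertices. -/
def IsTypical (prior : Fin K → ℝ) (B : Matrix (Fin K) (Fin K) ℝ) (Y : ℕ → Ω → Fin K)
    (A : ℕ → ℕ → Ω → Bool) (n : ℕ) (δ : ℝ) (ω : Ω) : Prop :=
  ∀ i j : Fin (n + 1), i ≠ j → ∀ o,
    |∑ k : {k : Fin (n + 1) // k ≠ i ∧ k ≠ j}, (observable o (Y k ω, A k i ω, A k j ω) -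
      observableMean prior B (Y i ω) (Y j ω) o)| < δ * (n - 1 : ℕ)

/-- Union bound over the `K + 2` observables, the pairs of vertices and their labels, which must be
fixed because the means depend on them. -/
theorem IsSBM.measureReal_not_isTypical_le [MeasurableSpace Ω] {μ : Measure Ω}
    [IsProbabilityMeasure μ] (h : IsSBM μ prior B Y A)
    (hprior : prior ∈ stdSimplex ℝ (Fin K)) (hBs : B.IsSymm)
    (hB : ∀ k l, B k l ∈ Set.Icc (0 : ℝ) 1) (n : ℕ) {δ : ℝ} (hδ0 : 0 ≤ δ) (hδ1 : δ ≤ 1) :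
    μ.real {ω | ¬ IsTypical prior B Y A n δ ω} ≤
      (K + 2) * ((n + 1) ^ 2 * (2 * Real.exp (-((n - 1 : ℕ) * δ ^ 2 / 4)))) := by
  let D (x : Option (Option (Fin K)) × (Fin (n + 1) × Fin (n + 1)) × Fin K × Fin K) : Set Ω :=
    {ω | x.2.1.1 ≠ x.2.1.2 ∧ Y x.2.1.1 ω = x.2.2.1 ∧ Y x.2.1.2 ω = x.2.2.2 ∧
      δ * (n - 1 : ℕ) ≤ |∑ k : {k : Fin (n + 1) // k ≠ x.2.1.1 ∧ k ≠ x.2.1.2},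
        (observable x.1 (Y k ω, A k x.2.1.1 ω, A k x.2.1.2 ω) -
          observableMean prior B x.2.2.1 x.2.2.2 x.1)|}
  have hsub : {ω | ¬ IsTypical prior B Y A n δ ω} ⊆ ⋃ x, D x := by
    intro ω hω
    simp only [IsTypical, Set.mem_ofPred_eq] at hω
    push Not at hω
    obtain ⟨i, j, hij, o, ho⟩ := hω
    exact Set.mem_iUnion.2 ⟨(o, (i, j), Y i ω, Y j ω), hij, rfl, rfl, ho⟩
  have hD : ∀ x, μ.real (D x) ≤ prior x.2.2.1 * prior x.2.2.2 *
      (2 * Real.exp (-((n - 1 : ℕ) * δ ^ 2 / 4))) := by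
    rintro ⟨o, ⟨i, j⟩, q, r⟩
    by_cases hij : i = j
    · have : D (o, (i, j), q, r) = ∅ := by
        ext ω; simp [D, hij]
      rw [this, measureReal_empty]
      exact mul_nonneg (mul_nonneg (hprior.1 _) (hprior.1 _)) (by positivity)
    · refine le_trans (measureReal_mono ?_ (measure_ne_top μ _))
        (h.measureReal_deviation_le hprior hBs hB hij q r (observable_mem o) hδ0 hδ1)
      exact fun ω hω => hω.2
  refine (measureReal_mono hsub (measure_ne_top μ _)).trans
    ((measureReal_iUnion_fintype_le _).trans ((Finset.sum_le_sum fun x _ => hD x).trans_eq ?_))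
  simp only [Fintype.sum_prod_type, ← Finset.sum_mul, ← Finset.mul_sum, hprior.2]
  simp
  ring

theorem IsSBM.ae_prior_pos [MeasurableSpace Ω] {μ : Measure Ω}
    [IsProbabilityMeasure μ] (h : IsSBM μ prior B Y A)
    (hprior : prior ∈ stdSimplex ℝ (Fin K)) (hBs : B.IsSymm)
    (hB : ∀ k l, B k l ∈ Set.Icc (0 : ℝ) 1) : ∀ᵐ ω ∂μ, ∀ i, 0 < prior (Y i ω) := by
  refine ae_all_iff.2 fun i => ?_
  have hzero : ∀ q r, prior q = 0 → ∀ᵐ ω ∂μ, ¬ (Y i ω = q ∧ Y (i + 1) ω = r) := by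
    intro q r hq
    -- With `δ = 0` the deviation condition is vacuous, and the bound vanishes with `prior q`.
    have h1 := h.measureReal_deviation_le hprior hBs hB (N := i + 2) (i := ⟨i, by omega⟩)
      (j := ⟨i + 1, by omega⟩) (by simp) q r (observable_mem none) le_rfl zero_le_one
    rw [hq, zero_mul, zero_mul, zero_mul] at h1
    have h2 := (measureReal_eq_zero_iff (measure_ne_top μ _)).1
      (le_antisymm h1 measureReal_nonneg)
    rw [ae_iff]
    refine measure_mono_null (fun ω hω => ?_) h2
    simp only [Set.mem_ofPred_eq, not_not] at hω
    exact ⟨hω.1, hω.2, by simp⟩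
  have hall : ∀ᵐ ω ∂μ, ∀ q r, prior q = 0 → ¬ (Y i ω = q ∧ Y (i + 1) ω = r) :=
    ae_all_iff.2 fun q => ae_all_iff.2 fun r => by
      by_cases hq : prior q = 0
      · filter_upwards [hzero q r hq] with ω hω _ using hω
      · exact Eventually.of_forall fun ω h0 => absurd h0 hq
  filter_upwards [hall] with ω hω
  refine lt_of_le_of_ne (hprior.1 _) fun h0 => hω _ _ h0.symm ⟨rfl, rfl⟩

/-- Column entries run over all training vertices, while independence needs `i` and `j` left out;
the difference is `f i + f j - f 0`. -/
theorem abs_sum_succ_sub_sum_le {n : ℕ} {f : Fin (n + 1) → ℝ} (hf : ∀ k, f k ∈ Set.Icc (0 : ℝ) 1)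
    {i j : Fin (n + 1)} (hij : i ≠ j) :
    |∑ k : Fin n, f k.succ - ∑ k : {k : Fin (n + 1) // k ≠ i ∧ k ≠ j}, f k| ≤ 2 := by
  have h1 := Fin.sum_univ_succ f
  have h2 : ∑ k, f k = f i + f j + ∑ k : {k : Fin (n + 1) // k ≠ i ∧ k ≠ j}, f k := by
    rw [← Finset.sum_subtype ((Finset.univ.erase i).erase j) (by simp [and_comm]) f,
      add_assoc, Finset.add_sum_erase _ f (by simp [hij.symm]), Finset.add_sum_erase _ f (by simp)]
  have h3 := hf 0
  have h4 := hf i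
  have h5 := hf j
  rw [abs_le]
  constructor <;> linarith [h3.1, h3.2, h4.1, h4.2, h5.1, h5.2]

/-- In a typical graph, averages over the training vertices are nearly their means. -/
theorem IsTypical.abs_average_sub_le {n : ℕ} {δ : ℝ} {ω : Ω} (h : IsTypical prior B Y A n δ ω)
    (hn : 2 ≤ δ * (n - 1 : ℕ)) (hδ : 0 < δ) {i j : Fin (n + 1)} (hij : i ≠ j)
    (o : Option (Option (Fin K))) :
    |(∑ k : Fin n, observable o (Y (k + 1) ω, A (k + 1) i ω, A (k + 1) j ω)) / (n - 1 : ℕ) -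
      observableMean prior B (Y i ω) (Y j ω) o| ≤ 2 * δ := by
  have hM : (0 : ℝ) < (n - 1 : ℕ) := by
    by_contra! h0
    nlinarith
  have h1 := h i j hij o
  have h2 := abs_sum_succ_sub_sum_le (f := fun k => observable o (Y k ω, A k i ω, A k j ω))
    (fun k => observable_mem o _) hij
  have hcard : Fintype.card {k : Fin (n + 1) // k ≠ i ∧ k ≠ j} = n - 1 := by
    rw [Fintype.card_of_subtype ((Finset.univ.erase i).erase j) (by simp [and_comm]),
      Finset.card_erase_of_mem (by simp [hij.symm]), Finset.card_erase_of_mem (by simp),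
      Finset.card_univ, Fintype.card_fin]
    omega
  rw [Finset.sum_sub_distrib, Finset.sum_const, Finset.card_univ, hcard, nsmul_eq_mul] at h1
  simp only [Fin.val_succ] at h2
  set m := observableMean prior B (Y i ω) (Y j ω) o
  set S := ∑ k : Fin n, observable o (Y (k + 1) ω, A (k + 1) i ω, A (k + 1) j ω)
  have h3 : |S - (n - 1 : ℕ) * m| ≤ 2 * δ * (n - 1 : ℕ) := by
    rw [abs_lt] at h1
    rw [abs_le] at h2 ⊢
    constructor <;> linarith [h1.1, h1.2, h2.1, h2.2]
  have h4 : S / (n - 1 : ℕ) - m = (S - (n - 1 : ℕ) * m) / (n - 1 : ℕ) := by field_simp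
  rw [h4, abs_div, abs_of_pos hM, div_le_iff₀ hM]
  exact h3

theorem norm_toLp_ite_sq {n : ℕ} (v : Fin n → Bool) :
    ‖(WithLp.toLp 2 (fun i => if v i then (1 : ℝ) else 0) : EuclideanSpace ℝ (Fin n))‖ ^ 2 =
      ∑ k, if v k then (1 : ℝ) else 0 := by
  rw [EuclideanSpace.norm_sq_eq]
  refine Finset.sum_congr rfl fun k _ => ?_
  by_cases h : v k <;> simp [h]

theorem inner_unitVec {n : ℕ} (v w : Fin n → Bool) :
    inner ℝ (unitVec v) (unitVec w) = (∑ k, if v k ∧ w k then (1 : ℝ) else 0) /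
      (√(∑ k, if v k then (1 : ℝ) else 0) * √(∑ k, if w k then (1 : ℝ) else 0)) := by
  rw [← norm_toLp_ite_sq v, ← norm_toLp_ite_sq w, Real.sqrt_sq (norm_nonneg _),
    Real.sqrt_sq (norm_nonneg _), unitVec, unitVec]
  simp only [inner_smul_left, inner_smul_right, PiLp.inner_apply]
  have : ∀ k, inner ℝ (if v k then (1 : ℝ) else 0) (if w k then (1 : ℝ) else 0) =
      if v k ∧ w k then (1 : ℝ) else 0 := by
    intro k
    by_cases h1 : v k <;> by_cases h2 : w k <;> simp [h1, h2]
  simp only [this]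
  rw [div_eq_mul_inv, mul_inv]
  simp only [conj_trivial]
  ring

theorem inner_unitVec_nonneg {n : ℕ} (v w : Fin n → Bool) :
    0 ≤ inner ℝ (unitVec v) (unitVec w) := by
  rw [inner_unitVec]
  refine div_nonneg (Finset.sum_nonneg fun k _ => ?_) (by positivity)
  split_ifs <;> norm_num

theorem norm_unitVec {n : ℕ} {v : Fin n → Bool}
    (h : 0 < ∑ k, if v k then (1 : ℝ) else 0) : ‖unitVec v‖ = 1 := by
  rw [← norm_toLp_ite_sq] at h
  have : ‖(WithLp.toLp 2 (fun i => if v i then (1 : ℝ) else 0) :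
      EuclideanSpace ℝ (Fin n))‖ ≠ 0 := by
    intro h0; rw [h0] at h; norm_num at h
  rw [unitVec, norm_smul, norm_inv, norm_norm, inv_mul_cancel₀ this]

/-- The limit of the cosine between the adjacency columns of vertices of classes `q` and `r`. -/
noncomputable def limitCos (prior : Fin K → ℝ) (B : Matrix (Fin K) (Fin K) ℝ) (q r : Fin K) : ℝ :=
  labelExp prior (blockVar B q * blockVar B r) /
    (√(labelExp prior (blockVar B q)) * √(labelExp prior (blockVar B r)))

/-- Margins for which averages within `2 * δ` of their means have cosines within `δ'` of their
limits. -/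
structure IsMargin (prior : Fin K → ℝ) (B : Matrix (Fin K) (Fin K) ℝ) (δ' δ : ℝ) : Prop where
  pos : 0 < δ
  le_prior : ∀ q, 0 < prior q → 4 * δ ≤ prior q
  lt_labelExp : ∀ q, 0 < prior q → 2 * δ < labelExp prior (blockVar B q)
  cos_le : ∀ q r, 0 < prior q → 0 < prior r → ∀ x y z,
    |x - labelExp prior (blockVar B q * blockVar B r)| ≤ 2 * δ →
    |y - labelExp prior (blockVar B q)| ≤ 2 * δ → |z - labelExp prior (blockVar B r)| ≤ 2 * δ →
    |x / (√y * √z) - limitCos prior B q r| ≤ δ'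

/-- Continuity of `x / (√y * √z)` at the means, where the denominator is positive; finitely many
conditions hold for all small `δ`. -/
theorem exists_isMargin (hpos : ∀ q, 0 < prior q → 0 < labelExp prior (blockVar B q))
    {δ' : ℝ} (hδ' : 0 < δ') : ∃ δ ≤ 1, IsMargin prior B δ' δ := by
  have hlim : Tendsto (fun δ : ℝ => 4 * δ) (𝓝[>] 0) (𝓝 0) := by
    have : Tendsto (fun δ : ℝ => 4 * δ) (𝓝 0) (𝓝 (4 * 0)) := Continuous.tendsto (by fun_prop) _
    rw [mul_zero] at this
    exact this.mono_left nhdsWithin_le_nhds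
  have h1 : ∀ᶠ δ in 𝓝[>] (0 : ℝ), ∀ q, 0 < prior q → 4 * δ ≤ prior q := by
    refine eventually_all.2 fun q => ?_
    by_cases hq : 0 < prior q
    · filter_upwards [hlim.eventually (gt_mem_nhds hq)] with δ h _ using h.le
    · exact Eventually.of_forall fun δ h => absurd h hq
  have h2 : ∀ᶠ δ in 𝓝[>] (0 : ℝ), ∀ q, 0 < prior q → 4 * δ < labelExp prior (blockVar B q) := by
    refine eventually_all.2 fun q => ?_
    by_cases hq : 0 < prior q
    · filter_upwards [hlim.eventually (gt_mem_nhds (hpos q hq))] with δ h _ using h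
    · exact Eventually.of_forall fun δ h => absurd h hq
  have h3 : ∀ᶠ δ in 𝓝[>] (0 : ℝ), ∀ q r, 0 < prior q → 0 < prior r → ∀ x y z,
      |x - labelExp prior (blockVar B q * blockVar B r)| ≤ 2 * δ →
      |y - labelExp prior (blockVar B q)| ≤ 2 * δ → |z - labelExp prior (blockVar B r)| ≤ 2 * δ →
      |x / (√y * √z) - limitCos prior B q r| ≤ δ' := by
    refine eventually_all.2 fun q => eventually_all.2 fun r => ?_
    by_cases hq : 0 < prior q
    swap
    · exact Eventually.of_forall fun δ h => absurd h hq
    by_cases hr : 0 < prior r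
    swap
    · exact Eventually.of_forall fun δ _ h => absurd h hr
    have hq' := hpos q hq
    have hr' := hpos r hr
    have hcont : ContinuousAt (fun p : ℝ × ℝ × ℝ => p.1 / (√p.2.1 * √p.2.2))
        (labelExp prior (blockVar B q * blockVar B r), labelExp prior (blockVar B q),
          labelExp prior (blockVar B r)) := by
      refine ContinuousAt.div (by fun_prop) (by fun_prop) ?_
      exact mul_ne_zero (Real.sqrt_pos.2 hq').ne' (Real.sqrt_pos.2 hr').ne'
    obtain ⟨ε, hε, hball⟩ := Metric.continuousAt_iff.1 hcont δ' hδ'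
    filter_upwards [hlim.eventually (gt_mem_nhds hε), self_mem_nhdsWithin]
      with δ hδ hδ0 _ _ x y z hx hy hz
    have hδ0 : 0 < δ := hδ0
    have := hball (x := (x, y, z)) (by
      simp only [Prod.dist_eq, Real.dist_eq, max_lt_iff]
      exact ⟨by linarith, by linarith, by linarith⟩)
    rw [Real.dist_eq] at this
    exact this.le
  obtain ⟨δ, ⟨⟨⟨h1, h2⟩, h3⟩, hδ0, hδ1⟩⟩ := (((h1.and h2).and h3).and
    (Ioo_mem_nhdsGT (zero_lt_one' ℝ))).exists
  exact ⟨δ, hδ1.le, hδ0, h1, fun q hq => by linarith [h2 q hq], h3⟩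

/-! ### Columns of a typical graph -/

section Column

variable {n : ℕ} {δ' δ : ℝ} {ω : Ω}

/-- The vertex `j` is auxiliary: typicality speaks of pairs, and this observable ignores the second
vertex. -/
theorem IsTypical.degree_average (h : IsTypical prior B Y A n δ ω) (hmar : IsMargin prior B δ' δ)
    (hn : 2 ≤ δ * (n - 1 : ℕ)) {i j : Fin (n + 1)} (hij : i ≠ j) :
    |(∑ k : Fin n, if A (k + 1) i ω then (1 : ℝ) else 0) / (n - 1 : ℕ) -
      labelExp prior (blockVar B (Y i ω))| ≤ 2 * δ := by
  have := h.abs_average_sub_le hn hmar.pos hij (some none)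
  rw [observableMean_edge] at this
  simpa only [observable] using this

theorem IsTypical.norm_column (h : IsTypical prior B Y A n δ ω) (hmar : IsMargin prior B δ' δ)
    (hn : 2 ≤ δ * (n - 1 : ℕ)) (hpos : ∀ i, 0 < prior (Y i ω)) {i j : Fin (n + 1)} (hij : i ≠ j) :
    ‖unitVec (fun k : Fin n => A (k + 1) i ω)‖ = 1 := by
  refine norm_unitVec ?_
  by_contra! h0
  have h1 := (abs_le.1 (h.degree_average hmar hn hij)).1
  have h2 := hmar.lt_labelExp _ (hpos i)
  have h3 := div_nonpos_of_nonpos_of_nonneg h0 (Nat.cast_nonneg (α := ℝ) (n - 1))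
  linarith

theorem IsTypical.abs_inner_column_sub_le (h : IsTypical prior B Y A n δ ω)
    (hmar : IsMargin prior B δ' δ) (hn : 2 ≤ δ * (n - 1 : ℕ)) (hpos : ∀ i, 0 < prior (Y i ω))
    {i j : Fin (n + 1)} (hij : i ≠ j) :
    |inner ℝ (unitVec (fun k : Fin n => A (k + 1) i ω)) (unitVec (fun k : Fin n => A (k + 1) j ω)) -
      limitCos prior B (Y i ω) (Y j ω)| ≤ δ' := by
  have hM : (0 : ℝ) < (n - 1 : ℕ) := by
    by_contra! h0
    nlinarith [hmar.pos]
  have h1 := h.abs_average_sub_le hn hmar.pos hij none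
  rw [observableMean_common] at h1
  have h2 := hmar.cos_le _ _ (hpos i) (hpos j) _ _ _ h1 (h.degree_average hmar hn hij)
    (h.degree_average hmar hn hij.symm)
  rw [inner_unitVec]
  convert h2 using 3
  -- A cosine is unchanged when all three counts are divided by `n - 1`.
  rw [Real.sqrt_div' _ hM.le, Real.sqrt_div' _ hM.le, div_mul_div_comm, Real.mul_self_sqrt hM.le,
    div_div_div_cancel_right₀ hM.ne']
  rfl

theorem IsTypical.lt_card_label (h : IsTypical prior B Y A n δ ω) (hmar : IsMargin prior B δ' δ)
    {s : ℕ} (hn : s + 2 ≤ δ * (n - 1 : ℕ)) {m : Fin K} (hm : 0 < prior m) :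
    s < Finset.card {k : Fin n | Y (k + 1) ω = m} := by
  have hs : (0 : ℝ) ≤ s := Nat.cast_nonneg s
  have hM : (0 : ℝ) < (n - 1 : ℕ) := by
    by_contra! h0
    nlinarith [hmar.pos]
  have hn1 : 0 < n - 1 := by exact_mod_cast hM
  have hij : (0 : Fin (n + 1)) ≠ Fin.last n := by
    rw [Ne, Fin.ext_iff]; simp; omega
  have h1 := (abs_le.1 (h.abs_average_sub_le (by linarith) hmar.pos hij (some (some m)))).1
  rw [observableMean_label] at h1
  simp only [observable] at h1
  have h2 := hmar.le_prior m hm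
  -- The prior is at least `4 * δ` and the error at most `2 * δ`; the class then has at least `2 *
  -- (s + 2)` members.
  have h3 : 2 * δ ≤ (∑ k : Fin n, if Y (k + 1) ω = m then (1 : ℝ) else 0) / (n - 1 : ℕ) := by
    linarith
  rw [le_div_iff₀ hM, Finset.sum_boole] at h3
  have : (s : ℝ) < (Finset.card {k : Fin n | Y (k + 1) ω = m} : ℝ) := by linarith
  exact_mod_cast this

end Column

end Typical

/-! ### Consistency -/

/-! ### The correlation hypothesis as a gap between limiting cosines -/

section Margin

variable {K : ℕ} {prior : Fin K → ℝ} {B : Matrix (Fin K) (Fin K) ℝ}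

theorem labelExp_pos {f : Fin K → ℝ} (hprior : prior ∈ stdSimplex ℝ (Fin K))
    (hf : ∀ k, 0 ≤ f k) {k : Fin K} (hk : 0 < prior k) (hfk : 0 < f k) :
    0 < labelExp prior f :=
  Finset.sum_pos' (fun l _ => mul_nonneg (hprior.1 l) (hf l))
    ⟨k, Finset.mem_univ k, mul_pos hk hfk⟩

theorem limitCos_self {q : Fin K} (hq : 0 < labelExp prior (blockVar B q)) :
    limitCos prior B q q =
      labelExp prior (blockVar B q * blockVar B q) / labelExp prior (blockVar B q) := by
  rw [limitCos, Real.mul_self_sqrt hq.le]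

theorem limitCos_comm (q r : Fin K) : limitCos prior B q r = limitCos prior B r q := by
  rw [limitCos, limitCos, mul_comm (blockVar B q), mul_comm (√_)]

/-- In the notation of the proof, `hcond` simplifies to `a ^ 2 / P ^ 2 < f / e`, that is `a ^ 2 / (e
* f) < (P / e) ^ 2`: the claim squared. -/
theorem limitCos_lt_self {q r : Fin K}
    (hq : 0 < labelExp prior (blockVar B q)) (hr : 0 < labelExp prior (blockVar B r))
    (hq2 : 0 < labelExp prior (blockVar B q * blockVar B q))
    (hr2 : 0 < labelExp prior (blockVar B r * blockVar B r))
    (hcond : rho prior B q r ^ 2 *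
        (labelExp prior (blockVar B r ^ 2) / labelExp prior (blockVar B q ^ 2)) <
      labelExp prior (blockVar B r) / labelExp prior (blockVar B q)) :
    limitCos prior B r q < limitCos prior B q q := by
  rw [limitCos_self hq, limitCos_comm, limitCos]
  rw [rho, pow_two (blockVar B q), pow_two (blockVar B r), div_pow,
    Real.sq_sqrt (mul_pos hq2 hr2).le] at hcond
  set a := labelExp prior (blockVar B q * blockVar B r)
  set P := labelExp prior (blockVar B q * blockVar B q)
  set R := labelExp prior (blockVar B r * blockVar B r)
  set e := labelExp prior (blockVar B q)
  set f := labelExp prior (blockVar B r)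
  have h1 : a ^ 2 / (P * R) * (R / P) = a ^ 2 / P ^ 2 := by field_simp
  rw [h1, div_lt_div_iff₀ (by positivity) hq] at hcond
  refine lt_of_pow_lt_pow_left₀ 2 (by positivity) ?_
  rw [div_pow, mul_pow, Real.sq_sqrt hq.le, Real.sq_sqrt hr.le, div_pow,
    div_lt_div_iff₀ (by positivity) (by positivity)]
  nlinarith

theorem exists_limitCos_margin (hprior : prior ∈ stdSimplex ℝ (Fin K))
    (hB : ∀ k l, B k l ∈ Set.Icc (0 : ℝ) 1)
    (hnondeg : ∀ q, 0 < prior q → ∃ k, 0 < prior k ∧ B k q ∈ Set.Ioo (0 : ℝ) 1)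
    (hcond : ∀ q r, q ≠ r →
      rho prior B q r ^ 2 *
          (labelExp prior (blockVar B r ^ 2) / labelExp prior (blockVar B q ^ 2)) <
        labelExp prior (blockVar B r) / labelExp prior (blockVar B q)) :
    (∀ q, 0 < prior q → 0 < labelExp prior (blockVar B q)) ∧
    ∃ η : ℝ, 0 < η ∧ η ≤ 1 ∧ ∀ q, 0 < prior q →
      limitCos prior B q q ≤ 1 - η ∧ η ≤ limitCos prior B q q ∧
      ∀ r, 0 < prior r → r ≠ q → limitCos prior B r q + η ≤ limitCos prior B q q := by
  have hE : ∀ q, 0 < prior q → 0 < labelExp prior (blockVar B q) := by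
    intro q hq
    obtain ⟨k, hk, hkq⟩ := hnondeg q hq
    exact labelExp_pos hprior (fun l => (hB l q).1) hk hkq.1
  have hE2 : ∀ q, 0 < prior q → 0 < labelExp prior (blockVar B q * blockVar B q) := by
    intro q hq
    obtain ⟨k, hk, hkq⟩ := hnondeg q hq
    exact labelExp_pos hprior (fun l => mul_self_nonneg _) hk (mul_pos hkq.1 hkq.1)
  have hlt : ∀ q, 0 < prior q → limitCos prior B q q < 1 := by
    intro q hq
    obtain ⟨k, hk, hkq⟩ := hnondeg q hq
    rw [limitCos_self (hE q hq), div_lt_one (hE q hq), ← sub_pos]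
    -- E(Q_q) - E(Q_q²) = E(Q_q(1 - Q_q)) is positive by non-degeneracy.
    have h1 : labelExp prior (blockVar B q) - labelExp prior (blockVar B q * blockVar B q) =
        labelExp prior (fun l => B l q * (1 - B l q)) := by
      simp only [labelExp, ← Finset.sum_sub_distrib]
      refine Finset.sum_congr rfl fun l _ => ?_
      simp only [blockVar, Pi.mul_apply]
      ring
    rw [h1]
    exact labelExp_pos hprior (fun l => mul_nonneg (hB l q).1 (by linarith [(hB l q).2])) hk
      (mul_pos hkq.1 (by linarith [hkq.2]))
  have hpos : ∀ q, 0 < prior q → 0 < limitCos prior B q q := by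
    intro q hq
    rw [limitCos_self (hE q hq)]
    exact div_pos (hE2 q hq) (hE q hq)
  have hsmall : ∀ x : ℝ, 0 < x → ∀ᶠ η in 𝓝[>] (0 : ℝ), η ≤ x := fun x hx =>
    nhdsWithin_le_nhds ((gt_mem_nhds hx).mono fun _ h => h.le)
  have hall : ∀ᶠ η in 𝓝[>] (0 : ℝ), ∀ q, 0 < prior q →
      limitCos prior B q q ≤ 1 - η ∧ η ≤ limitCos prior B q q ∧
      ∀ r, 0 < prior r → r ≠ q → limitCos prior B r q + η ≤ limitCos prior B q q := by
    refine eventually_all.2 fun q => ?_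
    by_cases hq : 0 < prior q
    swap
    · exact Eventually.of_forall fun η h => absurd h hq
    have h3 : ∀ᶠ η in 𝓝[>] (0 : ℝ), ∀ r, 0 < prior r → r ≠ q →
        limitCos prior B r q + η ≤ limitCos prior B q q := by
      refine eventually_all.2 fun r => ?_
      by_cases hr : 0 < prior r ∧ r ≠ q
      · have := limitCos_lt_self (hE q hq) (hE r hr.1) (hE2 q hq) (hE2 r hr.1)
          (hcond q r hr.2.symm)
        filter_upwards [hsmall _ (sub_pos.2 this)] with η h _ _ using by linarith
      · exact Eventually.of_forall fun η h h' => absurd ⟨h, h'⟩ hr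
    filter_upwards [hsmall _ (sub_pos.2 (hlt q hq)), hsmall _ (hpos q hq), h3] with η h1 h2 h3 _
    exact ⟨by linarith, h2, h3⟩
  obtain ⟨η, h1, h2, h3⟩ := (hall.and (Ioo_mem_nhdsGT (zero_lt_one' ℝ))).exists
  exact ⟨hE, η, h2, h3.le, h1⟩

end Margin

/-! ### From typical graphs to almost sure convergence -/

section Consistency

variable {Ω : Type*} {K : ℕ}
  {prior : Fin K → ℝ} {B : Matrix (Fin K) (Fin K) ℝ} {Y : ℕ → Ω → Fin K} {A : ℕ → ℕ → Ω → Bool}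

/-- Typicality covers pairs containing vertex 0, so the test column is treated like any other;
training index `j` is vertex `j + 1`. -/
theorem IsTypical.isSeparated {n s : ℕ} {δ δ' η : ℝ} {ω : Ω} (h : IsTypical prior B Y A n δ ω)
    (hmar : IsMargin prior B δ' δ) (hn : s + 2 ≤ δ * (n - 1 : ℕ)) (hpos : ∀ i, 0 < prior (Y i ω))
    (hη : ∀ q, 0 < prior q → limitCos prior B q q ≤ 1 - η ∧ η ≤ limitCos prior B q q ∧
      ∀ r, 0 < prior r → r ≠ q → limitCos prior B r q + η ≤ limitCos prior B q q) :
    IsSeparated (dictionary (trainData Y A n ω).2) (unitVec (testColumn A n ω))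
      (trainData Y A n ω).1 (Y 0 ω) (limitCos prior B) s η δ' := by
  have hn' : 2 ≤ δ * (n - 1 : ℕ) := by linarith [Nat.cast_nonneg (α := ℝ) s]
  have hd : ∀ j : Fin n, dictionary (trainData Y A n ω).2 j =
      unitVec (fun k : Fin n => A (k + 1) j.succ ω) := fun j => rfl
  have hφ : unitVec (testColumn A n ω) =
      unitVec (fun k : Fin n => A (k + 1) (0 : Fin (n + 1)) ω) := by
    rw [Fin.val_zero]; rfl
  have hy : ∀ j : Fin n, (trainData Y A n ω).1 j = Y j.succ ω := fun j => rfl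
  have hy0 : Y 0 ω = Y (0 : Fin (n + 1)) ω := by rw [Fin.val_zero]
  refine ⟨fun j => ?_, fun i j => ?_, fun i j hij => ?_, fun j => ?_, fun j => (hη _ (hpos _)).1,
    fun j hj => (hη _ (hpos 0)).2.2 _ (hpos _) hj, (hη _ (hpos 0)).2.1, fun j => ?_, ?_⟩
  · rw [hd]
    exact h.norm_column hmar hn' hpos (Fin.succ_ne_zero j)
  · exact inner_unitVec_nonneg _ _
  · rw [hd, hd, hy, hy]
    exact h.abs_inner_column_sub_le hmar hn' hpos (fun he => hij (Fin.succ_injective n he))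
  · rw [hd, hφ, hy, hy0]
    exact h.abs_inner_column_sub_le hmar hn' hpos (Fin.succ_ne_zero j)
  · exact h.lt_card_label hmar hn (hpos _)
  · exact h.lt_card_label hmar hn (hpos 0)

/-- If the probabilities of misclassification are summable, the conditional ones vanish almost
surely. -/
theorem ae_tendsto_condError [MeasurableSpace Ω] {μ : Measure Ω} [IsProbabilityMeasure μ]
    (hY : ∀ i, Measurable (Y i)) (hA : ∀ i j, Measurable (A i j)) {g : Classifier K}
    (hsum : Summable fun n => μ.real (errorEvent Y A g n)) :
    ∀ᵐ ω ∂μ, Tendsto (fun n => condError μ Y A g n ω) atTop (𝓝 0) := by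
  have htrain : ∀ n, Measurable (trainData Y A n) := fun n =>
    (measurable_pi_lambda _ fun i => hY _).prodMk
      (measurable_pi_lambda _ fun i => measurable_pi_lambda _ fun j => hA _ _)
  have htest : ∀ n, Measurable (testColumn A n) := fun n => measurable_pi_lambda _ fun i => hA _ _
  have hmeas : ∀ n, MeasurableSet (errorEvent Y A g n) := by
    intro n
    have h1 : Measurable fun ω => ((trainData Y A n ω, testColumn A n ω), Y 0 ω) :=
      ((htrain n).prodMk (htest n)).prodMk (hY 0)
    exact h1 (MeasurableSet.of_discrete
      (s := {x | g n x.1.1.1 x.1.1.2 x.1.2 ≠ x.2}))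
  have hnn : ∀ n, 0 ≤ᵐ[μ] condError μ Y A g n := fun n =>
    condExp_nonneg (Eventually.of_forall fun ω => Set.indicator_nonneg (by simp) ω)
  have hint : ∀ n, ∫ ω, condError μ Y A g n ω ∂μ = μ.real (errorEvent Y A g n) := by
    intro n
    rw [condError, integral_condExp (htrain n).comap_le, integral_indicator (hmeas n)]
    simp
  have hlint : ∀ n, ∫⁻ ω, ENNReal.ofReal (condError μ Y A g n ω) ∂μ =
      ENNReal.ofReal (μ.real (errorEvent Y A g n)) := fun n => by
    rw [← hint]
    exact (ofReal_integral_eq_lintegral_ofReal integrable_condExp (hnn n)).symm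
  have hae : ∀ n, AEMeasurable (fun ω => ENNReal.ofReal (condError μ Y A g n ω)) μ := fun n =>
    (integrable_condExp.aestronglyMeasurable.aemeasurable).ennreal_ofReal
  -- By Tonelli the expected sum of the conditional errors is the sum of the error probabilities; a
  -- series that is finite almost surely has terms tending to 0.
  have hfin : ∀ᵐ ω ∂μ, ∑' n, ENNReal.ofReal (condError μ Y A g n ω) < ⊤ := by
    refine ae_lt_top' (AEMeasurable.tsum hae) ?_
    rw [lintegral_tsum hae]
    simp only [hlint]
    exact hsum.tsum_ofReal_ne_top
  filter_upwards [hfin, ae_all_iff.2 hnn] with ω hω hω0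
  have h1 := ENNReal.tendsto_atTop_zero_of_tsum_ne_top hω.ne
  have h2 := (ENNReal.tendsto_toReal ENNReal.zero_ne_top).comp h1
  refine h2.congr fun n => ?_
  exact ENNReal.toReal_ofReal (hω0 n)

theorem summable_deviation_bound (C : ℝ) {a : ℝ} (ha : 0 < a) :
    Summable fun n : ℕ => C * (((n : ℝ) + 1) ^ 2 * (2 * Real.exp (-((n - 1 : ℕ) * a)))) := by
  refine Summable.mul_left _ ?_
  -- The shift removes the truncated subtraction, leaving `2 * (n + 2) ^ 2 = 2 * n ^ 2 + 8 * n + 8`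
  -- times a geometric term.
  rw [← summable_nat_add_iff 1]
  have hr : ‖Real.exp (-a)‖ < 1 := by
    rw [Real.norm_eq_abs, abs_of_pos (Real.exp_pos _)]
    exact Real.exp_lt_one_iff.2 (by linarith)
  have h0 := summable_pow_mul_geometric_of_norm_lt_one 0 hr
  have h1 := summable_pow_mul_geometric_of_norm_lt_one 1 hr
  have h2 := summable_pow_mul_geometric_of_norm_lt_one 2 hr
  refine ((h2.mul_left 2).add ((h1.mul_left 8).add (h0.mul_left 8))).congr fun n => ?_
  have : Real.exp (-(((n + 1 - 1 : ℕ) : ℝ) * a)) = Real.exp (-a) ^ n := by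
    rw [← Real.exp_nat_mul, Nat.add_sub_cancel]; congr 1; ring
  rw [this]
  push_cast
  ring

/-- A classifier that is right on separated data is consistent. -/
theorem IsSBM.ae_tendsto_condError_of_isSeparated [MeasurableSpace Ω] {μ : Measure Ω}
    [IsProbabilityMeasure μ] (hSBM : IsSBM μ prior B Y A)
    (hprior : prior ∈ stdSimplex ℝ (Fin K)) (hBsymm : B.IsSymm)
    (hB : ∀ k l, B k l ∈ Set.Icc (0 : ℝ) 1) {s : ℕ} {g : Classifier K} {η δ' : ℝ}
    (hE : ∀ q, 0 < prior q → 0 < labelExp prior (blockVar B q))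
    (hη : ∀ q, 0 < prior q → limitCos prior B q q ≤ 1 - η ∧ η ≤ limitCos prior B q q ∧
      ∀ r, 0 < prior r → r ≠ q → limitCos prior B r q + η ≤ limitCos prior B q q)
    (hδ' : 0 < δ')
    (hg : ∀ n (y : Fin n → Fin K) (a : Fin n → Fin n → Bool) (v : Fin n → Bool) (q : Fin K),
      IsSeparated (dictionary a) (unitVec v) y q (limitCos prior B) s η δ' → g n y a v = q) :
    ∀ᵐ ω ∂μ, Tendsto (fun n => condError μ Y A g n ω) atTop (𝓝 0) := by
  obtain ⟨δ, hδ1, hmar⟩ := exists_isMargin hE hδ'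
  refine ae_tendsto_condError hSBM.measurable_label hSBM.measurable_adj ?_
  have hlarge : ∀ᶠ n : ℕ in atTop, (s : ℝ) + 2 ≤ δ * (n - 1 : ℕ) := by
    have h1 : Tendsto (fun n : ℕ => δ * ((n - 1 : ℕ) : ℝ)) atTop atTop :=
      (tendsto_natCast_atTop_atTop.comp (tendsto_sub_atTop_nat 1)).const_mul_atTop hmar.pos
    exact h1.eventually_ge_atTop _
  have hbound : ∀ᶠ n : ℕ in atTop, ‖μ.real (errorEvent Y A g n)‖ ≤
      (K + 2) * (((n : ℝ) + 1) ^ 2 * (2 * Real.exp (-((n - 1 : ℕ) * (δ ^ 2 / 4))))) := by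
    filter_upwards [hlarge] with n hn
    rw [Real.norm_eq_abs, abs_of_nonneg measureReal_nonneg, ← mul_div_assoc]
    refine le_trans ?_ (hSBM.measureReal_not_isTypical_le hprior hBsymm hB n hmar.pos.le hδ1)
    refine ENNReal.toReal_mono (measure_ne_top μ _) (measure_mono_ae ?_)
    filter_upwards [hSBM.ae_prior_pos hprior hBsymm hB] with ω hω herr htyp
    exact herr (hg n _ _ _ _ (htyp.isSeparated hmar hn hω hη))
  exact Summable.of_norm_bounded_eventually_nat
    (summable_deviation_bound _ (by have := hmar.pos; positivity)) hbound

end Consistency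

end VertexSRC

theorem mainTheorem1 {K : ℕ} (prior : Fin K → ℝ) (hprior : prior ∈ stdSimplex ℝ (Fin K))
    (B : Matrix (Fin K) (Fin K) ℝ) (hBsymm : B.IsSymm)
    (hB : ∀ k l, B k l ∈ Set.Icc (0 : ℝ) 1)
    (hnondeg : ∀ q, 0 < prior q → ∃ k, 0 < prior k ∧ B k q ∈ Set.Ioo (0 : ℝ) 1)
    (hcond : ∀ q r, q ≠ r →
      VertexSRC.rho prior B q r ^ 2 *
          (VertexSRC.labelExp prior (VertexSRC.blockVar B r ^ 2) /
            VertexSRC.labelExp prior (VertexSRC.blockVar B q ^ 2)) <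
        VertexSRC.labelExp prior (VertexSRC.blockVar B r) /
          VertexSRC.labelExp prior (VertexSRC.blockVar B q))
    {Ω : Type*} [MeasurableSpace Ω] (μ : Measure Ω) [IsProbabilityMeasure μ]
    (Y : ℕ → Ω → Fin K) (A : ℕ → ℕ → Ω → Bool) (hSBM : VertexSRC.IsSBM μ prior B Y A)
    (s : ℕ) (hs : 1 ≤ s) (g : VertexSRC.Classifier K) :
    (VertexSRC.IsL1SRC s g →
      ∀ᵐ ω ∂μ, Tendsto (fun n => VertexSRC.condError μ Y A g n ω) atTop (𝓝 0)) ∧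
    (VertexSRC.IsOMPSRC s g →
      ∀ᵐ ω ∂μ, Tendsto (fun n => VertexSRC.condError μ Y A g n ω) atTop (𝓝 0)) := by
  obtain ⟨hE, η, hη0, hη1, hη⟩ :=
    VertexSRC.exists_limitCos_margin hprior hB hnondeg hcond
  have hs1 : (1 : ℝ) ≤ s := by exact_mod_cast hs
  -- The tolerance is dictated by matching pursuit; since `s + 1 ≤ 2 * s`, it also meets the weaker
  -- demand of ℓ1 minimization.
  obtain ⟨δ', hδ0, hδ⟩ : ∃ δ' : ℝ, 0 < δ' ∧ 64 * s * δ' = η ^ 2 :=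
    ⟨η ^ 2 / (64 * s), by positivity, by field_simp⟩
  have hδ1 : 16 * (s + 1) * δ' ≤ η ^ 2 := by nlinarith
  have hδ2 : 2 * δ' < η := by nlinarith
  constructor
  · intro hg
    refine hSBM.ae_tendsto_condError_of_isSeparated hprior hBsymm hB hE hη hδ0 ?_ (s := s)
    intro n y a v q hsep
    obtain ⟨β, hβ, hmin⟩ := hg n y a v (hsep.exists_l1Representation hη0 hδ2)
    obtain ⟨h1, h2⟩ := hsep.l1_representation hδ0.le hη0 hη1 hδ1 hβ
    exact VertexSRC.eq_of_classResidual_le h1 h2 hmin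
  · intro hg
    refine hSBM.ae_tendsto_condError_of_isSeparated hprior hBsymm hB hE hη hδ0 ?_ (s := s)
    intro n y a v q hsep
    obtain ⟨S, β, hS⟩ := hsep.exists_ompState s
    obtain ⟨β, hβ, hmin⟩ := hg n y a v ⟨β, S, hS⟩
    obtain ⟨h1, h2⟩ := hsep.omp_representation hs hδ0.le hη0 hη1 hδ.le hβ
    exact VertexSRC.eq_of_classResidual_le h1 h2 hmin
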